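/- **Definitions.** Let $G$ be a finite group. A *partial action* of $G$ on a C*-algebra $A$ is a family of closed two-sided ideals $A_g\subseteq A$ and $*$-isomorphisms $\alpha_g\colon A_{g^{-1}}\to A_g$ ($g\in G$) such that $A_1=A$, $\alpha_1=\mathrm{id}_A$, and $\alpha_{gh}$ extends $\alpha_g\circ\alpha_h$ for all $g,h\in G$. For $d\in\mathbb N=\{0,1,2,\dots\}$ write $\dim_{\mathrm{Rok}}(\alpha)\le d$ if for every $\varepsilon>0$ and every finite $F\subseteq A$ there are positive contractions $f_g^{(j)}\in A_g$ ($g\in G$, $0\le j\le d$) such that for all $g,h\in G$, all $0\le j\le d$ and all $a,b\in F$: 1. $\|(\alpha_g(f_h^{(j)}x)-f_{gh}^{(j)}\alpha_g(x))a\|<\varepsilon$ for all $x\in F\cap A_{g^{-1}}$; 2. $\|f_g^{(j)}f_h^{(j)}a\|<\varepsilon$ if $g\ne h$; 3. $\|(\sum_{i=0}^d\sum_{k\in G}f_k^{(i)})a-a\|<\varepsilon$; 4. $\|(f_g^{(j)}b-bf_g^{(j)})a\|<\varepsilon$. The Rokhlin dimension $\dim_{\mathrm{Rok}}(\alpha)$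 is the least such $d$, and $\infty$ if there is none. A *partial action* of $G$ on a topological space $X$ is a family of open sets $X_g\subseteq X$ and homeomorphisms $\theta_g\colon X_{g^{-1}}\to X_g$ ($g\in G$) such that $X_1=X$, $\theta_1=\mathrm{id}_X$, and $\theta_{gh}$ extends $\theta_g\circ\theta_h$ for all $g,h\in G$. It is *free* if $\theta_g(x)\neq x$ for all $g\ne1$ and all $x\in X_{g^{-1}}$. If $X$ is locally compact Hausdorff, the induced partial action $\alpha$ on $C_0(X)$ has $A_g=C_0(X_g)$ and $\alpha_g(f)=f\circ\theta_g^{-1}$ for $f\in C_0(X_{g^{-1}})$. $\dim(X)$ denotes the covering dimension: the least $n\in\mathbb N$ such that every finite open cover of $X$ has a finite open refinement, again a cover, in which every point lies in at most $n+1$ members, and $\infty$ if there is no such $n$. **Theorem.** Let $\theta$ be a partial action of a finite group $G$ on a locally compact Hausdorff space $X$, and let $\alpha$ be the induced partial action of $G$ on $C_0(X)$. (a) If $\dim_{\mathrm{Rok}}(\alpha)<\infty$, then $\theta$ is free. (b) Suppose that $\dim(X)<\infty$. Then $\dim_{\mathrm{Rok}}(\alpha)<\infty$ if and only if $\theta$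 is free, in which case $$\dim_{\mathrm{Rok}}(\alpha)\le(|G|-1)(\dim(X)+1).$$ -/

import Mathlib

open Set Filter Topology TopologicalSpace
open scoped ZeroAtInfty

/-! ### Covering dimension -/

/-- Every finite open cover of `X` has a finite open refinement covering `X` such that every point
of `X` lies in at most `n + 1` members of the refinement. -/
def CoveringDimLE (X : Type*) [TopologicalSpace X] (n : ℕ) : Prop :=
  ∀ 𝒰 : Set (Set X), 𝒰.Finite → (∀ U ∈ 𝒰, IsOpen U) → ⋃₀ 𝒰 = univ →
    ∃ 𝒱 : Set (Set X), 𝒱.Finite ∧ (∀ V ∈ 𝒱, IsOpen V) ∧ ⋃₀ 𝒱 = univ ∧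
      (∀ V ∈ 𝒱, ∃ U ∈ 𝒰, V ⊆ U) ∧ ∀ x : X, {V ∈ 𝒱 | x ∈ V}.encard ≤ n + 1

/-- The (Lebesgue) covering dimension of `X`, with values in `{0, 1, 2, …, ∞}`
(the value for the empty space is `0`). -/
noncomputable def coveringDim (X : Type*) [TopologicalSpace X] : ℕ∞ :=
  ⨅ (n : ℕ) (_ : CoveringDimLE X n), (n : ℕ∞)

/-! ### Topological partial actions -/

/-- A topological partial action of a (discrete) group `G` on a space `X`: open subsets `X_g`
(`dom g`) and homeomorphisms `θ_g : X_{g⁻¹} → X_g` (`act g`) such that `X_1 = X`, `θ_1 = id`, and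
`θ_{gh}` extends `θ_g ∘ θ_h` (which is defined at the points `x ∈ X_{h⁻¹}` such that
`θ_h x ∈ X_{g⁻¹}`). -/
structure TopPartialAction (G X : Type*) [Group G] [TopologicalSpace X] where
  dom : G → Opens X
  act : ∀ g : G, dom g⁻¹ ≃ₜ dom g
  dom_one : dom 1 = ⊤
  act_one : ∀ x : dom (1 : G)⁻¹, (act 1 x : X) = x
  act_mul : ∀ (g h : G) (x : dom h⁻¹) (hx : (act h x : X) ∈ dom g⁻¹),
    ∃ hx' : (x : X) ∈ dom (g * h)⁻¹, (act (g * h) ⟨x, hx'⟩ : X) = act g ⟨act h x, hx⟩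

/-- A topological partial action is free if `θ_g x ≠ x` for all `g ≠ 1` and `x ∈ X_{g⁻¹}`. -/
def TopPartialAction.IsFree {G X : Type*} [Group G] [TopologicalSpace X]
    (θ : TopPartialAction G X) : Prop :=
  ∀ g : G, g ≠ 1 → ∀ x : θ.dom g⁻¹, (θ.act g x : X) ≠ x

/-! ### Partial actions on C*-algebras and Rokhlin dimension -/

/-- A partial action of a (discrete) group `G` on a C*-algebra `A`: closed two-sided ideals `A_g`
(`dom g`; closed two-sided ideals of a C*-algebra are automatically star-closed subspaces) and
star-isomorphisms `α_g : A_{g⁻¹} → A_g` (`act g`) such that `A_1 = A`, `α_1 = id`, and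
`α_{gh}` extends `α_g ∘ α_h`. -/
structure CStarPartialAction (G A : Type*) [Group G] [NonUnitalCStarAlgebra A] where
  dom : G → NonUnitalStarSubalgebra ℂ A
  isClosed_dom : ∀ g : G, IsClosed (dom g : Set A)
  mul_mem_left : ∀ (g : G) (a : A) {x : A}, x ∈ dom g → a * x ∈ dom g
  mul_mem_right : ∀ (g : G) {x : A} (a : A), x ∈ dom g → x * a ∈ dom g
  act : ∀ g : G, dom g⁻¹ ≃⋆ₐ[ℂ] dom g
  dom_one : dom 1 = ⊤
  act_one : ∀ x : dom (1 : G)⁻¹, (act 1 x : A) = x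
  act_mul : ∀ (g h : G) (x : dom h⁻¹) (hx : (act h x : A) ∈ dom g⁻¹),
    ∃ hx' : (x : A) ∈ dom (g * h)⁻¹, (act (g * h) ⟨x, hx'⟩ : A) = act g ⟨act h x, hx⟩

namespace CStarPartialAction

variable {G A : Type*} [Group G] [Fintype G] [NonUnitalCStarAlgebra A]

/-- The family `f j g` (`j = 0, …, d` and `g ∈ G`) consists of Rokhlin towers for `(F, ε)`:
positive contractions `f j g ∈ A_g` that are approximately equivariant, approximately orthogonal
within each tower, approximately sum to one, and approximately central, as witnessed on the
finite set `F`. -/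
structure IsRokhlinTowers (α : CStarPartialAction G A) (F : Finset A) (ε : ℝ) {d : ℕ}
    (f : Fin (d + 1) → G → A) : Prop where
  mem_dom : ∀ j g, f j g ∈ α.dom g
  pos : ∀ j g, ∃ b : A, f j g = star b * b
  norm_le_one : ∀ j g, ‖f j g‖ ≤ 1
  equivariant : ∀ j g h, ∀ a ∈ F, ∀ x : α.dom g⁻¹, (x : A) ∈ F →
    ‖((α.act g ⟨f j h * x, α.mul_mem_left g⁻¹ (f j h) x.2⟩ : A) - f j (g * h) * α.act g x) * a‖ < ε
  orthogonal : ∀ j g h, g ≠ h → ∀ a ∈ F, ‖f j g * f j h * a‖ < ε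
  sum_one : ∀ a ∈ F, ‖(∑ j, ∑ g, f j g) * a - a‖ < ε
  central : ∀ j g, ∀ a ∈ F, ∀ b ∈ F, ‖(f j g * b - b * f j g) * a‖ < ε

/-- The partial action `α` has Rokhlin dimension at most `d`. -/
def RokhlinDimLE (α : CStarPartialAction G A) (d : ℕ) : Prop :=
  ∀ ε : ℝ, 0 < ε → ∀ F : Finset A, ∃ f : Fin (d + 1) → G → A, α.IsRokhlinTowers F ε f

/-- The Rokhlin dimension of `α`: the least `d` such that `α` has Rokhlin dimension at most `d`,
and `∞` if there is no such `d`. -/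
noncomputable def rokhlinDim (α : CStarPartialAction G A) : ℕ∞ :=
  ⨅ (d : ℕ) (_ : α.RokhlinDimLE d), (d : ℕ∞)

end CStarPartialAction

/-! ### The induced partial action on `C₀(X)` -/

namespace ZeroAtInftyContinuousMap

variable {X : Type*} [TopologicalSpace X]

/-- The ideal of `C₀(X)` of the functions that vanish outside the open set `U`, that is, the
canonical copy of `C₀(U)`. -/
def vanishingOff (U : Opens X) : NonUnitalStarSubalgebra ℂ C₀(X, ℂ) where
  carrier := {f | ∀ x ∉ U, f x = 0}
  add_mem' := by
    intro a b ha hb x hx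
    simp [ha x hx, hb x hx]
  zero_mem' := by
    intro x _
    rfl
  mul_mem' := by
    intro a b ha hb x hx
    simp [ha x hx]
  smul_mem' := by
    intro c a ha x hx
    simp [ha x hx]
  star_mem' := by
    intro a ha x hx
    simp [ha x hx]

lemma mem_vanishingOff {U : Opens X} {f : C₀(X, ℂ)} :
    f ∈ vanishingOff U ↔ ∀ x ∉ U, f x = 0 := Iff.rfl

lemma isClosed_vanishingOff (U : Opens X) : IsClosed (vanishingOff U : Set C₀(X, ℂ)) := by
  have h : (vanishingOff U : Set C₀(X, ℂ)) = ⋂ x ∈ {x : X | x ∉ U}, {f | f x = 0} := by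
    ext f
    simp [mem_vanishingOff]
  rw [h]
  refine isClosed_biInter fun x _ => ?_
  have hc : Continuous fun f : C₀(X, ℂ) => f x := by
    have h1 : Continuous fun f : C₀(X, ℂ) => f.toBCF :=
      (isometry_toBCF (α := X) (β := ℂ)).continuous
    exact (BoundedContinuousFunction.evalCLM ℂ x).continuous.comp h1
  exact isClosed_singleton.preimage hc

open Classical in
/-- The function `f ∘ e⁻¹` on `V`, extended by zero to `X`. -/
noncomputable def pushFun {U V : Opens X} (e : U ≃ₜ V) (f : X → ℂ) (y : X) : ℂ :=
  if hy : y ∈ V then f (e.symm ⟨y, hy⟩) else 0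

lemma pushFun_apply {U V : Opens X} (e : U ≃ₜ V) (f : X → ℂ) (x : U) :
    pushFun e f (e x) = f x := by
  simp [pushFun]

lemma pushFun_of_notMem {U V : Opens X} (e : U ≃ₜ V) (f : X → ℂ) {y : X} (hy : y ∉ V) :
    pushFun e f y = 0 := by
  simp [pushFun, hy]

lemma isCompact_pushFun {U V : Opens X} (e : U ≃ₜ V) (f : vanishingOff U) {ε : ℝ} (hε : 0 < ε) :
    IsCompact {y | ε ≤ ‖pushFun e (f : C₀(X, ℂ)) y‖} := by
  set K : Set X := {x | ε ≤ ‖(f : C₀(X, ℂ)) x‖} with hK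
  have hKclosed : IsClosed K :=
    isClosed_le continuous_const (map_continuous (f : C₀(X, ℂ))).norm
  have hKc : IsCompact K := by
    have h0 := zero_at_infty (f : C₀(X, ℂ))
    have h1 : ∀ᶠ x in cocompact X, ‖(f : C₀(X, ℂ)) x‖ < ε := by
      have := h0.norm
      rw [norm_zero] at this
      exact this.eventually_lt_const hε
    obtain ⟨C, hC, hCs⟩ := mem_cocompact.1 h1
    refine hC.of_isClosed_subset hKclosed fun x hx => ?_
    by_contra hxC
    have h2 : ‖(f : C₀(X, ℂ)) x‖ < ε := hCs hxC
    exact absurd h2 (not_lt.2 hx)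
  have hKU : K ⊆ range ((↑) : U → X) := by
    intro x hx
    by_contra hxU
    have hx' : x ∉ U := fun h => hxU ⟨⟨x, h⟩, rfl⟩
    have h2 : (f : C₀(X, ℂ)) x = 0 := f.2 x hx'
    rw [hK, mem_ofPred_eq, h2, norm_zero] at hx
    exact absurd hx (not_le.2 hε)
  have hKU' : IsCompact (((↑) : U → X) ⁻¹' K) :=
    (Topology.IsInducing.subtypeVal.isCompact_preimage_iff hKU).2 hKc
  have himg : {y | ε ≤ ‖pushFun e (f : C₀(X, ℂ)) y‖}
      = (fun x : U => (e x : X)) '' (((↑) : U → X) ⁻¹' K) := by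
    ext y
    constructor
    · intro hy
      by_cases hyV : y ∈ V
      · refine ⟨e.symm ⟨y, hyV⟩, ?_, by simp⟩
        have : pushFun e (f : C₀(X, ℂ)) y = (f : C₀(X, ℂ)) (e.symm ⟨y, hyV⟩) := by
          simp [pushFun, hyV]
        rw [mem_ofPred_eq, this] at hy
        exact hy
      · rw [mem_ofPred_eq, pushFun_of_notMem e _ hyV, norm_zero] at hy
        exact absurd hy (not_le.2 hε)
    · rintro ⟨x, hx, rfl⟩
      rw [mem_ofPred_eq, pushFun_apply]
      exact hx
  rw [himg]
  exact hKU'.image (continuous_subtype_val.comp e.continuous)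

lemma continuous_pushFun [T2Space X] {U V : Opens X} (e : U ≃ₜ V) (f : vanishingOff U) :
    Continuous (pushFun e (f : C₀(X, ℂ))) := by
  rw [continuous_iff_continuousAt]
  intro y
  by_cases hy : y ∈ V
  · have h1 : ContinuousOn (pushFun e (f : C₀(X, ℂ))) V := by
      rw [continuousOn_iff_continuous_domRestrict]
      have : (V : Set X).domRestrict (pushFun e (f : C₀(X, ℂ)))
          = fun v : V => (f : C₀(X, ℂ)) (e.symm v) := by
        ext v
        have hv : (v : X) ∈ V := v.2
        simp [pushFun, hv]
      rw [this]
      exact (map_continuous (f : C₀(X, ℂ))).comp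
        (continuous_subtype_val.comp e.symm.continuous)
    exact h1.continuousAt (V.isOpen.mem_nhds hy)
  · rw [ContinuousAt, pushFun_of_notMem e _ hy, Metric.tendsto_nhds]
    intro ε hε
    have hc := (isCompact_pushFun e f hε).isClosed.isOpen_compl
    have hmem : y ∈ {y | ε ≤ ‖pushFun e (f : C₀(X, ℂ)) y‖}ᶜ := by
      simp [pushFun_of_notMem e _ hy, hε]
    filter_upwards [hc.mem_nhds hmem] with z hz
    simpa using hz

/-- The map `C₀(U) → C₀(V)`, `f ↦ f ∘ e⁻¹`, induced by a homeomorphism `e : U → V`. -/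
noncomputable def push [T2Space X] {U V : Opens X} (e : U ≃ₜ V) (f : vanishingOff U) : vanishingOff V :=
  ⟨{ toFun := pushFun e (f : C₀(X, ℂ))
     continuous_toFun := continuous_pushFun e f
     zero_at_infty' := by
      rw [Metric.tendsto_nhds]
      intro ε hε
      filter_upwards [(isCompact_pushFun e f hε).compl_mem_cocompact] with z hz
      simpa using hz },
   fun _ hy => pushFun_of_notMem e _ hy⟩

lemma push_apply [T2Space X] {U V : Opens X} (e : U ≃ₜ V) (f : vanishingOff U) (x : U) :
    (push e f : C₀(X, ℂ)) (e x) = (f : C₀(X, ℂ)) x :=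
  pushFun_apply e _ x

lemma push_of_notMem [T2Space X] {U V : Opens X} (e : U ≃ₜ V) (f : vanishingOff U) {y : X} (hy : y ∉ V) :
    (push e f : C₀(X, ℂ)) y = 0 :=
  pushFun_of_notMem e _ hy

lemma vanishingOff_ext {V : Opens X} {f f' : vanishingOff V}
    (h : ∀ y : V, (f : C₀(X, ℂ)) y = (f' : C₀(X, ℂ)) y) : f = f' := by
  apply Subtype.ext
  ext y
  by_cases hy : y ∈ V
  · exact h ⟨y, hy⟩
  · rw [f.2 y hy, f'.2 y hy]

lemma push_ext {U V : Opens X} (e : U ≃ₜ V) {f f' : vanishingOff V}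
    (h : ∀ x : U, (f : C₀(X, ℂ)) (e x) = (f' : C₀(X, ℂ)) (e x)) : f = f' := by
  refine vanishingOff_ext fun y => ?_
  have := h (e.symm y)
  rwa [e.apply_symm_apply] at this

/-- The star-isomorphism `C₀(U) → C₀(V)`, `f ↦ f ∘ e⁻¹`, induced by a homeomorphism
`e : U → V`. -/
noncomputable def pushEquiv [T2Space X] {U V : Opens X} (e : U ≃ₜ V) :
    vanishingOff U ≃⋆ₐ[ℂ] vanishingOff V where
  toFun := push e
  invFun := push e.symm
  left_inv f := by
    refine vanishingOff_ext fun x => ?_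
    have := push_apply e.symm (push e f) (e x)
    rw [e.symm_apply_apply] at this
    rw [this, push_apply]
  right_inv f := by
    refine vanishingOff_ext fun y => ?_
    have := push_apply e (push e.symm f) (e.symm y)
    rw [e.apply_symm_apply] at this
    rw [this, push_apply]
  map_mul' f f' := push_ext e fun x => by simp [push_apply]
  map_add' f f' := push_ext e fun x => by simp [push_apply]
  map_star' f := push_ext e fun x => by simp [push_apply]
  map_smul' c f := push_ext e fun x => by simp [push_apply]

@[simp] lemma pushEquiv_apply [T2Space X] {U V : Opens X} (e : U ≃ₜ V) (f : vanishingOff U) :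
    pushEquiv e f = push e f := rfl

end ZeroAtInftyContinuousMap

open ZeroAtInftyContinuousMap in
/-- The partial action of `G` on `C₀(X)` induced by a topological partial action `θ` of `G` on
the Hausdorff space `X`: the ideal `A_g` is `C₀(X_g)`, and
`α_g f = f ∘ θ_g⁻¹` for `f ∈ C₀(X_{g⁻¹})`. -/
noncomputable def TopPartialAction.toCStar {G X : Type*} [Group G] [TopologicalSpace X]
    [T2Space X] (θ : TopPartialAction G X) : CStarPartialAction G C₀(X, ℂ) where
  dom g := vanishingOff (θ.dom g)
  isClosed_dom g := isClosed_vanishingOff _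
  mul_mem_left g a x hx := by
    intro y hy
    simp [hx y hy]
  mul_mem_right g x a hx := by
    intro y hy
    simp [hx y hy]
  act g := pushEquiv (θ.act g)
  dom_one := by
    refine SetLike.ext fun f => ⟨fun _ => NonUnitalStarAlgebra.mem_top, fun _ x hx => ?_⟩
    rw [θ.dom_one] at hx
    exact absurd (Opens.mem_top x) hx
  act_one f := by
    ext y
    have hy : y ∈ θ.dom (1 : G)⁻¹ := by
      rw [inv_one, θ.dom_one]
      exact Opens.mem_top y
    have h := push_apply (θ.act 1) f ⟨y, hy⟩
    rwa [θ.act_one] at h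
  act_mul g h f hf := by
    have key : ∀ x : X, (f : C₀(X, ℂ)) x ≠ 0 → ∃ (hx : x ∈ θ.dom h⁻¹)
        (hx1 : (θ.act h ⟨x, hx⟩ : X) ∈ θ.dom g⁻¹) (hx2 : x ∈ θ.dom (g * h)⁻¹),
        (θ.act (g * h) ⟨x, hx2⟩ : X) = θ.act g ⟨θ.act h ⟨x, hx⟩, hx1⟩ := by
      intro x hx
      have h1 : x ∈ θ.dom h⁻¹ := by
        by_contra hn
        exact hx (f.2 x hn)
      have h2 : (θ.act h ⟨x, h1⟩ : X) ∈ θ.dom g⁻¹ := by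
        by_contra hn
        have h3 := hf _ hn
        rw [pushEquiv_apply, push_apply] at h3
        exact hx h3
      obtain ⟨h4, h5⟩ := θ.act_mul g h ⟨x, h1⟩ h2
      exact ⟨h1, h2, h4, h5⟩
    have hmem : (f : C₀(X, ℂ)) ∈ vanishingOff (θ.dom (g * h)⁻¹) := by
      intro x hx
      by_contra hne
      obtain ⟨_, _, h3, _⟩ := key x hne
      exact hx h3
    refine ⟨hmem, ?_⟩
    ext y
    simp only [pushEquiv_apply]
    -- the right-hand side at a point where it can be nonzero
    by_cases hex : ∃ x : X, (f : C₀(X, ℂ)) x ≠ 0 ∧ ∃ hx : x ∈ θ.dom (g * h)⁻¹,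
        (θ.act (g * h) ⟨x, hx⟩ : X) = y
    · obtain ⟨x, hne, hx, rfl⟩ := hex
      obtain ⟨h1, h2, h3, h4⟩ := key x hne
      rw [push_apply, h4, push_apply]
      exact (push_apply (θ.act h) f ⟨x, h1⟩).symm
    · have hL : (push (θ.act (g * h)) ⟨f, hmem⟩ : C₀(X, ℂ)) y = 0 := by
        by_cases hy : y ∈ θ.dom (g * h)
        · obtain ⟨x, hx⟩ := (θ.act (g * h)).surjective ⟨y, hy⟩
          have hxy : (θ.act (g * h) x : X) = y := congrArg Subtype.val hx
          rw [← hxy, push_apply]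
          by_contra hne
          exact hex ⟨x, hne, x.2, hxy⟩
        · exact push_of_notMem _ _ hy
      rw [hL]
      by_cases hy : y ∈ θ.dom g
      · obtain ⟨z, hz⟩ := (θ.act g).surjective ⟨y, hy⟩
        have hzy : (θ.act g z : X) = y := congrArg Subtype.val hz
        rw [← hzy, push_apply]
        symm
        change (push (θ.act h) f : C₀(X, ℂ)) z = 0
        by_cases hzh : (z : X) ∈ θ.dom h
        · obtain ⟨w, hw⟩ := (θ.act h).surjective ⟨z, hzh⟩
          have hwz : (θ.act h w : X) = z := congrArg Subtype.val hw
          rw [← hwz, push_apply]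
          by_contra hne
          obtain ⟨h1, h2, h3, h4⟩ := key w hne
          refine hex ⟨w, hne, h3, ?_⟩
          rw [h4, ← hzy]
          congr 2
          exact Subtype.ext hwz
        · exact push_of_notMem _ _ hzh
      · exact (push_of_notMem _ _ hy).symm

/-! ### Covering dimension -/

/-! Freeness is necessary because, at a fixed point of `θ_g` with `g ≠ 1`, equivariance makes the
values of `f_k` and `f_{gk}` nearly equal, while orthogonality makes their product nearly zero. All
tower values there are then small and cannot sum to nearly one (`isFree_of_rokhlinDimLE`).

For the bound, stratify `X` by the number of group elements that can be applied to a point. This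
number is constant on orbits and lower semicontinuous, so the superlevel sets are open and
invariant. Inside one stratum the domains are relatively clopen. A compact piece of a stratum
therefore has compact saturation, on which the action is free with clopen domains.

On such a compact space there are `n + 1` exact towers (`exists_exact_towers`). Finitely many sets
meeting each orbit at most once have saturations that cover the space. This cover is shrunk to an
invariant one of order at most `n + 1`, and a partition of unity is summed over orbits. The cells of
its barycentric subdivision are coloured by the size of their index set. Cells of the same colour
are disjoint, and each lies in the saturation of one of the separated sets, so each colour yields
one tower.

Strata are glued from the largest count downwards (`HasTowers.extend`): an almost invariant cut-off
`e` in the open part turns towers `f` there and exact towers `f'` on the complement into `e f` and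
`(1 - e) f'`. Each of the strata with counts `|G|, …, 2` costs `n + 1` towers. On the last one only
the identity acts and one tower suffices. The total `(|G| - 1)(n + 1) + 1` gives the bound, since
dimension `d` means `d + 1` towers. -/

theorem CoveringDimLE.of_isClosedEmbedding {X Z : Type*} [TopologicalSpace X] [TopologicalSpace Z]
    {n : ℕ} (h : CoveringDimLE X n) {e : Z → X} (he : IsClosedEmbedding e) :
    CoveringDimLE Z n := by
  intro 𝒰 hfin hopen hcov
  have hO : ∀ U ∈ 𝒰, ∃ O : Set X, IsOpen O ∧ e ⁻¹' O = U := fun U hU =>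
    he.isInducing.isOpen_iff.1 (hopen U hU)
  choose! O hO hOU using hO
  obtain ⟨𝒱, hVfin, hVo, hVc, hVr, hVn⟩ := h (insert (range e)ᶜ (O '' 𝒰))
    ((hfin.image _).insert _) (by
      rintro V (rfl | ⟨U, hU, rfl⟩)
      · exact he.isClosed_range.isOpen_compl
      · exact hO U hU) (by
      refine eq_univ_of_forall fun x => ?_
      by_cases hx : x ∈ range e
      · obtain ⟨z, rfl⟩ := hx
        obtain ⟨U, hU, hz⟩ := mem_sUnion.1 (hcov ▸ mem_univ z)
        refine mem_sUnion.2 ⟨O U, Or.inr ⟨U, hU, rfl⟩, ?_⟩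
        rw [← hOU U hU] at hz
        exact hz
      · exact mem_sUnion.2 ⟨_, Or.inl rfl, hx⟩)
  -- The empty set is dropped because the members of `𝒱` inside the complement of the range have
  -- empty trace, which need not lie in any member of `𝒰`.
  refine ⟨((e ⁻¹' ·) '' 𝒱) \ {∅}, (hVfin.image _).subset sdiff_subset, ?_, ?_, ?_, fun z => ?_⟩
  · rintro _ ⟨⟨V, hV, rfl⟩, -⟩
    exact (hVo V hV).preimage he.continuous
  · refine eq_univ_of_forall fun z => ?_
    obtain ⟨V, hV, hz⟩ := mem_sUnion.1 (hVc ▸ mem_univ (e z))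
    exact mem_sUnion.2 ⟨e ⁻¹' V, ⟨⟨V, hV, rfl⟩, fun h0 => (h0 ▸ hz : z ∈ (∅ : Set Z))⟩, hz⟩
  · rintro _ ⟨⟨V, hV, rfl⟩, hne⟩
    obtain ⟨z, hz⟩ := nonempty_iff_ne_empty.2 hne
    obtain ⟨U', hU' | ⟨U, hU, rfl⟩, hVU⟩ := hVr V hV
    · exact absurd (mem_range_self z) (hU' ▸ hVU hz)
    · exact ⟨U, hU, fun y hy => hOU U hU ▸ hVU hy⟩
  · refine le_trans ?_ (hVn (e z))
    refine le_trans (encard_le_encard ?_) (encard_image_le (e ⁻¹' ·) _)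
    rintro _ ⟨⟨⟨V, hV, rfl⟩, -⟩, hz⟩
    exact ⟨V, ⟨hV, hz⟩, rfl⟩

/-- Each member of a refinement is assigned to one index, and members with the same index are
merged; this cannot increase the order. -/
theorem CoveringDimLE.exists_shrinking {Z ι : Type*} [TopologicalSpace Z] [Finite ι]
    {n : ℕ} (h : CoveringDimLE Z n) (U : ι → Set Z) (hU : ∀ i, IsOpen (U i))
    (hc : ⋃ i, U i = univ) :
    ∃ V : ι → Set Z, (∀ i, IsOpen (V i)) ∧ (∀ i, V i ⊆ U i) ∧ ⋃ i, V i = univ ∧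
      ∀ x, {i | x ∈ V i}.encard ≤ n + 1 := by
  obtain ⟨𝒱, -, hVo, hVc, hVr, hVn⟩ := h (range U) (finite_range U)
    (by rintro _ ⟨i, rfl⟩; exact hU i) hc
  have : ∀ V ∈ 𝒱, ∃ i, V ⊆ U i := fun V hV => by
    obtain ⟨_, ⟨i, rfl⟩, hi⟩ := hVr V hV
    exact ⟨i, hi⟩
  rcases isEmpty_or_nonempty ι with hι | hι
  · exact ⟨U, hU, fun _ => Subset.rfl, hc, fun x => by simp [eq_empty_of_isEmpty]⟩
  choose! c hcV using this
  refine ⟨fun i => ⋃₀ {V ∈ 𝒱 | c V = i}, fun i => isOpen_sUnion fun V hV => hVo V hV.1,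
    fun i => sUnion_subset fun V hV => hV.2 ▸ hcV V hV.1, ?_, fun x => ?_⟩
  · refine eq_univ_of_forall fun x => ?_
    obtain ⟨V, hV, hx⟩ := mem_sUnion.1 (hVc ▸ mem_univ x)
    exact mem_iUnion.2 ⟨c V, V, ⟨hV, rfl⟩, hx⟩
  · refine le_trans ?_ (hVn x)
    refine le_trans (encard_le_encard ?_) (encard_image_le c _)
    rintro i ⟨V, ⟨hV, rfl⟩, hx⟩
    exact ⟨V, ⟨hV, hx⟩, rfl⟩

theorem exists_coveringDimLE_of_coveringDim_lt_top {X : Type*} [TopologicalSpace X]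
    (h : coveringDim X < ⊤) : ∃ n : ℕ, CoveringDimLE X n ∧ coveringDim X = n := by
  classical
  have hex : ∃ n, CoveringDimLE X n := by
    by_contra! hne
    simp [coveringDim, hne] at h
  refine ⟨Nat.find hex, Nat.find_spec hex, le_antisymm (iInf₂_le _ (Nat.find_spec hex)) ?_⟩
  exact le_iInf₂ fun m hm => Nat.cast_le.2 (Nat.find_min' hex hm)

/-! ### Partial actions by partially defined maps -/

/-- A partial action of `G` on a set `X`, written with total maps `map g` that are only relevant on
the sets `src g`. -/
structure PartialMaps (G X : Type*) [Group G] where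
  src : G → Set X
  map : G → X → X
  src_one : src 1 = univ
  map_one : ∀ x, map 1 x = x
  map_mem : ∀ g x, x ∈ src g → map g x ∈ src g⁻¹
  mul_mem : ∀ g h x, x ∈ src h → map h x ∈ src g → x ∈ src (g * h)
  map_mul : ∀ g h x, x ∈ src h → map h x ∈ src g → map (g * h) x = map g (map h x)

namespace PartialMaps

variable {G X : Type*} [Group G] (t : PartialMaps G X)

theorem mem_src_one (x : X) : x ∈ t.src 1 := t.src_one ▸ mem_univ x

theorem map_inv_map {g : G} {x : X} (hx : x ∈ t.src g) : t.map g⁻¹ (t.map g x) = x := by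
  rw [← t.map_mul g⁻¹ g x hx (t.map_mem g x hx), inv_mul_cancel, t.map_one]

theorem map_mem_src_iff {g h : G} {x : X} (hx : x ∈ t.src h) :
    t.map h x ∈ t.src g ↔ x ∈ t.src (g * h) := by
  refine ⟨t.mul_mem g h x hx, fun hgh => ?_⟩
  have := t.mul_mem (g * h) h⁻¹ (t.map h x) (t.map_mem h x hx) (by rwa [t.map_inv_map hx])
  rwa [mul_inv_cancel_right] at this

theorem map_map {g h : G} {x : X} (hx : x ∈ t.src h) (hgh : x ∈ t.src (g * h)) :
    t.map g (t.map h x) = t.map (g * h) x :=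
  (t.map_mul g h x hx ((t.map_mem_src_iff hx).2 hgh)).symm

theorem map_div_map {g h : G} {x : X} (hg : x ∈ t.src g) (hh : x ∈ t.src h) :
    t.map h x ∈ t.src (g * h⁻¹) ∧ t.map (g * h⁻¹) (t.map h x) = t.map g x := by
  have : x ∈ t.src (g * h⁻¹ * h) := by rwa [inv_mul_cancel_right]
  refine ⟨(t.map_mem_src_iff hh).2 this, ?_⟩
  rw [t.map_map hh this, inv_mul_cancel_right]

def IsFree : Prop := ∀ g x, x ∈ t.src g → t.map g x = x → g = 1

/-- The points that can be moved into `C`. -/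
def sat (C : Set X) : Set X := {x | ∃ g, x ∈ t.src g ∧ t.map g x ∈ C}

theorem subset_sat (C : Set X) : C ⊆ t.sat C := fun x hx =>
  ⟨1, t.mem_src_one x, by rwa [t.map_one]⟩

/-- Invariance of a set under a partial action. -/
def Invariant (C : Set X) : Prop := ∀ g x, x ∈ t.src g → (t.map g x ∈ C ↔ x ∈ C)

theorem invariant_of_imp {C : Set X} (h : ∀ g x, x ∈ t.src g → x ∈ C → t.map g x ∈ C) :
    t.Invariant C := fun g x hx => ⟨fun hm => by
  have := h g⁻¹ _ (t.map_mem g x hx) hm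
  rwa [t.map_inv_map hx] at this, h g x hx⟩

theorem invariant_sat (C : Set X) : t.Invariant (t.sat C) := by
  refine t.invariant_of_imp ?_
  rintro g x hx ⟨k, hk, hC⟩
  obtain ⟨h1, h2⟩ := t.map_div_map hk hx
  exact ⟨k * g⁻¹, h1, by rwa [h2]⟩

/-- `C` meets every orbit in at most one point, and with trivial stabilizer. -/
def Separated (C : Set X) : Prop := ∀ g x, x ∈ t.src g → x ∈ C → t.map g x ∈ C → g = 1

theorem sat_eq (C : Set X) : t.sat C = ⋃ g, (t.src g ∩ t.map g ⁻¹' C) := by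
  ext x; simp [sat]

variable [TopologicalSpace X]

theorem isOpen_sat (ho : ∀ g, IsOpen (t.src g)) (hm : ∀ g, ContinuousOn (t.map g) (t.src g))
    {C : Set X} (hC : IsOpen C) : IsOpen (t.sat C) := by
  rw [sat_eq]
  exact isOpen_iUnion fun g => (hm g).isOpen_inter_preimage (ho g) hC

variable [Finite G]

theorem isClosed_sat (hc : ∀ g, IsClosed (t.src g)) (hm : ∀ g, ContinuousOn (t.map g) (t.src g))
    {C : Set X} (hC : IsClosed C) : IsClosed (t.sat C) := by
  rw [sat_eq]
  exact isClosed_iUnion_of_finite fun g => (hm g).preimage_isClosed_of_isClosed (hc g) hC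

/-- For each `g ≠ 1`, either `x` is moved, and disjoint neighbourhoods of `x` and its image do the
job, or `x` has a neighbourhood off the closed domain. Finitely many such neighbourhoods are
intersected. -/
theorem exists_separated_nhds [T2Space X] [RegularSpace X] (hf : t.IsFree)
    (hc : ∀ g, IsClosed (t.src g)) (hm : ∀ g, Continuous (t.map g)) (x : X) :
    ∃ B ∈ 𝓝 x, IsClosed B ∧ t.Separated B := by
  have h1 : ∀ g, ∃ N ∈ 𝓝 x, ∀ y, y ∈ t.src g → y ∈ N → t.map g y ∈ N → g = 1 := by
    intro g
    by_cases hg : g = 1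
    · exact ⟨univ, univ_mem, fun _ _ _ _ => hg⟩
    by_cases hx : x ∈ t.src g
    · have hne : t.map g x ≠ x := fun h => hg (hf g x hx h)
      obtain ⟨u, v, hu, hv, hxu, hxv, huv⟩ := t2_separation hne
      refine ⟨v ∩ t.map g ⁻¹' u, inter_mem (hv.mem_nhds hxv)
        ((hm g).continuousAt (hu.mem_nhds hxu)), fun y _ hy hgy => ?_⟩
      exact (huv.le_bot ⟨hy.2, hgy.1⟩).elim
    · exact ⟨(t.src g)ᶜ, (hc g).isOpen_compl.mem_nhds hx, fun y hy hy' _ => absurd hy hy'⟩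
  choose N hN hsep using h1
  obtain ⟨B, hB, hBc, hBN⟩ := exists_mem_nhds_isClosed_subset (iInter_mem.2 hN)
  exact ⟨B, hB, hBc, fun g y hy hyB hgB =>
    hsep g y hy (mem_iInter.1 (hBN hyB) g) (mem_iInter.1 (hBN hgB) g)⟩

/-- One step of shrinking an invariant cover so that it gets order at most `n + 1` on the
saturation of a separated closed set `B`. -/
theorem exists_shrinking_of_separated {ι : Type*} [Finite ι] {n : ℕ} (hdim : CoveringDimLE X n)
    (hc : ∀ g, IsClosed (t.src g)) (hm : ∀ g, Continuous (t.map g)) {B : Set X} (hB : IsClosed B)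
    (hsep : t.Separated B) (U : ι → Set X) (hU : ∀ i, IsOpen (U i)) (hinv : ∀ i, t.Invariant (U i))
    (hcov : ⋃ i, U i = univ) :
    ∃ V : ι → Set X, (∀ i, IsOpen (V i)) ∧ (∀ i, t.Invariant (V i)) ∧ (∀ i, V i ⊆ U i) ∧
      ⋃ i, V i = univ ∧ ∀ x ∈ t.sat B, {i | x ∈ V i}.encard ≤ n + 1 := by
  obtain ⟨V, hVo, hVU, hVc, hVn⟩ := hdim.exists_shrinking U hU hcov
  -- `V` need not be invariant, so only its trace on `B` is used. Each orbit in the saturation of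
  -- `B` has a unique representative in `B`, and that point decides which of the new sets contain
  -- the orbit.
  refine ⟨fun i => U i \ t.sat (B \ V i), fun i => (hU i).sdiff
    (t.isClosed_sat hc (fun g => (hm g).continuousOn) (hB.sdiff (hVo i))), fun i g x hx => ?_,
    fun i => sdiff_subset, eq_univ_of_forall fun x => ?_, ?_⟩
  · rw [Set.mem_sdiff, Set.mem_sdiff, hinv i g x hx, t.invariant_sat _ g x hx]
  · by_cases hx : x ∈ t.sat B
    · obtain ⟨g, hg, hgB⟩ := hx
      obtain ⟨i, hi⟩ := mem_iUnion.1 (hVc ▸ mem_univ (t.map g x))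
      refine mem_iUnion.2 ⟨i, (hinv i g x hg).1 (hVU i hi), ?_⟩
      rintro ⟨h, hh, hhB, hhV⟩
      obtain ⟨h1, h2⟩ := t.map_div_map hh hg
      have h3 := hsep _ _ h1 hgB (by rwa [h2])
      rw [h3, t.map_one] at h2
      exact hhV (h2 ▸ hi)
    · obtain ⟨i, hi⟩ := mem_iUnion.1 (hcov ▸ mem_univ x)
      exact mem_iUnion.2 ⟨i, hi, fun ⟨g, hg, hgB⟩ => hx ⟨g, hg, hgB.1⟩⟩
  · rintro x ⟨g, hg, hgB⟩
    refine le_trans (encard_le_encard fun i hi => ?_) (hVn (t.map g x))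
    by_contra hV
    exact hi.2 ⟨g, hg, hgB, hV⟩

/-- The sets `B k` are treated one at a time: later shrinkings preserve the order bounds already
obtained. -/
theorem exists_invariant_shrinking {ι κ : Type*} [Finite ι] {n : ℕ} (hdim : CoveringDimLE X n)
    (hc : ∀ g, IsClosed (t.src g)) (hm : ∀ g, Continuous (t.map g)) (s : Finset κ) (B : κ → Set X)
    (hB : ∀ k, IsClosed (B k)) (hsep : ∀ k, t.Separated (B k)) (U : ι → Set X)
    (hU : ∀ i, IsOpen (U i)) (hinv : ∀ i, t.Invariant (U i)) (hcov : ⋃ i, U i = univ) :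
    ∃ V : ι → Set X, (∀ i, IsOpen (V i)) ∧ (∀ i, t.Invariant (V i)) ∧ (∀ i, V i ⊆ U i) ∧
      ⋃ i, V i = univ ∧ ∀ k ∈ s, ∀ x ∈ t.sat (B k), {i | x ∈ V i}.encard ≤ n + 1 := by
  classical
  induction s using Finset.induction_on with
  | empty => exact ⟨U, hU, hinv, fun _ => Subset.rfl, hcov, by simp⟩
  | insert k s _ ih =>
    obtain ⟨V, hVo, hVi, hVU, hVc, hVn⟩ := ih
    obtain ⟨W, hWo, hWi, hWV, hWc, hWn⟩ :=
      t.exists_shrinking_of_separated hdim hc hm (hB k) (hsep k) V hVo hVi hVc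
    refine ⟨W, hWo, hWi, fun i => (hWV i).trans (hVU i), hWc, fun l hl x hx => ?_⟩
    rcases Finset.mem_insert.1 hl with rfl | hl
    · exact hWn x hx
    · exact le_trans (encard_le_encard fun i hi => hWV i hi) (hVn l hl x hx)

end PartialMaps

/-! ### Sums over orbits -/

namespace PartialMaps

variable {G X : Type*} [Group G] (t : PartialMaps G X) [Fintype G]

/-- The sum of the values of `p` over the orbit of a point. -/
noncomputable def orbitSum (p : X → ℝ) (x : X) : ℝ :=
  ∑ g, (t.src g).indicator (fun y => p (t.map g y)) x

/-- Right multiplication by `h` matches the elements applicable at `t.map h x` with those applicable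
at `x`. -/
theorem orbitSum_map (p : X → ℝ) {h : G} {x : X} (hx : x ∈ t.src h) :
    t.orbitSum p (t.map h x) = t.orbitSum p x := by
  classical
  unfold orbitSum
  refine Fintype.sum_equiv (Equiv.mulRight h) _ _ fun g => ?_
  simp only [indicator_apply, Equiv.coe_mulRight, t.map_mem_src_iff hx]
  split_ifs with hg
  · rw [t.map_map hx hg]
  · rfl

theorem orbitSum_nonneg {p : X → ℝ} (hp : ∀ x, 0 ≤ p x) (x : X) : 0 ≤ t.orbitSum p x :=
  Finset.sum_nonneg fun _ _ => indicator_nonneg (fun _ _ => hp _) _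

theorem le_orbitSum {p : X → ℝ} (hp : ∀ x, 0 ≤ p x) {g : G} {x : X} (hx : x ∈ t.src g) :
    p (t.map g x) ≤ t.orbitSum p x := by
  have := Finset.single_le_sum (f := fun g => (t.src g).indicator (fun y => p (t.map g y)) x)
    (fun _ _ => indicator_nonneg (fun _ _ => hp _) _) (Finset.mem_univ g)
  simpa [orbitSum, hx] using this

theorem le_orbitSum_self {p : X → ℝ} (hp : ∀ x, 0 ≤ p x) (x : X) : p x ≤ t.orbitSum p x := by
  simpa [t.map_one] using t.le_orbitSum hp (t.mem_src_one x)

theorem exists_of_orbitSum_ne_zero {p : X → ℝ} {x : X} (h : t.orbitSum p x ≠ 0) :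
    ∃ g, x ∈ t.src g ∧ p (t.map g x) ≠ 0 := by
  obtain ⟨g, -, hg⟩ := Finset.exists_ne_zero_of_sum_ne_zero h
  exact ⟨g, mem_of_indicator_ne_zero hg, fun h0 => hg (by simp [h0])⟩

variable [TopologicalSpace X]

theorem continuous_orbitSum (hs : ∀ g, IsClopen (t.src g)) (hm : ∀ g, Continuous (t.map g))
    {p : X → ℝ} (hp : Continuous p) : Continuous (t.orbitSum p) :=
  continuous_finsetSum _ fun g _ => continuous_indicator
    (fun a ha => by rw [(hs g).frontier_eq] at ha; exact ha.elim) (hp.comp (hm g)).continuousOn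

end PartialMaps

/-! ### Barycentric subdivision of a family of functions -/

/-- A function which is positive exactly where all the functions `P i`, `i ∈ S`, are positive and
larger than all the other ones. -/
noncomputable def dominance {ι X : Type*} [Fintype ι] [DecidableEq ι] (P : ι → X → ℝ)
    (S : Finset ι) (x : X) : ℝ :=
  (∏ i ∈ S, P i x) * ∏ i ∈ S, ∏ j ∈ Sᶜ, max 0 (P i x - P j x)

section dominance

variable {ι X : Type*} [Fintype ι] [DecidableEq ι] {P : ι → X → ℝ} {S T : Finset ι} {x : X}

theorem dominance_nonneg (hP : ∀ i x, 0 ≤ P i x) : 0 ≤ dominance P S x :=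
  mul_nonneg (Finset.prod_nonneg fun _ _ => hP _ _)
    (Finset.prod_nonneg fun _ _ => Finset.prod_nonneg fun _ _ => le_max_left _ _)

theorem ne_zero_of_dominance_ne_zero (h : dominance P S x ≠ 0) {i : ι} (hi : i ∈ S) :
    P i x ≠ 0 :=
  Finset.prod_ne_zero_iff.1 (left_ne_zero_of_mul h) i hi

theorem lt_of_dominance_ne_zero (h : dominance P S x ≠ 0) {i j : ι} (hi : i ∈ S) (hj : j ∉ S) :
    P j x < P i x := by
  have := Finset.prod_ne_zero_iff.1 (Finset.prod_ne_zero_iff.1 (right_ne_zero_of_mul h) i hi) j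
    (Finset.mem_compl.2 hj)
  by_contra hle
  exact this (max_eq_left (by linarith))

/-- Distinct sets of equal size each contain an index missing from the other, and each of the two
values would have to exceed the other. This is why cells can be coloured by cardinality. -/
theorem eq_of_dominance_ne_zero (hS : dominance P S x ≠ 0) (hT : dominance P T x ≠ 0)
    (hc : S.card = T.card) : S = T := by
  by_contra hne
  obtain ⟨i, hiS, hiT⟩ := Finset.not_subset.1 fun h => hne (Finset.eq_of_subset_of_card_le h hc.ge)
  obtain ⟨j, hjT, hjS⟩ := Finset.not_subset.1 fun h =>
    hne (Finset.eq_of_subset_of_card_le h hc.le).symm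
  exact lt_asymm (lt_of_dominance_ne_zero hS hiS hjS) (lt_of_dominance_ne_zero hT hjT hiT)

theorem dominance_support_pos (hP : ∀ i x, 0 ≤ P i x) (x : X) :
    0 < dominance P {i | P i x ≠ 0} x := by
  refine mul_pos (Finset.prod_pos fun i hi => ?_)
    (Finset.prod_pos fun i hi => Finset.prod_pos fun j hj => ?_)
  · exact lt_of_le_of_ne (hP i x) (Ne.symm (by simpa using hi))
  · have hj0 : P j x = 0 := by simpa using hj
    have hi0 : 0 < P i x := lt_of_le_of_ne (hP i x) (Ne.symm (by simpa using hi))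
    simpa [hj0] using hi0

theorem continuous_dominance [TopologicalSpace X] (hP : ∀ i, Continuous (P i)) :
    Continuous (dominance P S) := by
  unfold dominance
  fun_prop

end dominance

/-! ### Exact towers on compact spaces with clopen domains -/

namespace PartialMaps

variable {G X : Type*} [Group G] (t : PartialMaps G X)

theorem dominance_map [Fintype G] {ι : Type*} [Fintype ι] [DecidableEq ι] (p : ι → X → ℝ) (S : Finset ι)
    {h : G} {x : X} (hx : x ∈ t.src h) :
    dominance (fun i => t.orbitSum (p i)) S (t.map h x) =
      dominance (fun i => t.orbitSum (p i)) S x := by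
  simp only [dominance, t.orbitSum_map _ hx]

/-- A separated open set is relatively closed in its saturation. -/
theorem Separated.notMem_sat_of_mem_frontier [TopologicalSpace X] {t : PartialMaps G X} (ho : ∀ g, IsOpen (t.src g))
    (hm : ∀ g, Continuous (t.map g)) {W : Set X} (hW : IsOpen W) (hs : t.Separated W) {x : X}
    (hx : x ∈ frontier W) : x ∉ t.sat W := by
  rintro ⟨g, hg, hgW⟩
  have hxW : x ∉ W := fun h => by
    rw [hW.frontier_eq] at hx
    exact hx.2 h
  have hN : t.src g ∩ t.map g ⁻¹' W ∈ 𝓝 x :=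
    ((ho g).inter (hW.preimage (hm g))).mem_nhds ⟨hg, hgW⟩
  obtain ⟨y, hy, hyW⟩ := mem_closure_iff_nhds.1 (frontier_subset_closure hx) _ hN
  have := hs g y hy.1 hyW hy.2
  rw [this, t.map_one] at hgW
  exact hxW hgW

/-- On a compact space of covering dimension at most `n`, a free partial action with clopen domains
admits `n + 1` exact Rokhlin towers. -/
theorem exists_exact_towers [Fintype G] [TopologicalSpace X] [CompactSpace X] [T2Space X] (hfree : t.IsFree)
    (hs : ∀ g, IsClopen (t.src g)) (hm : ∀ g, Continuous (t.map g)) {n : ℕ}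
    (hdim : CoveringDimLE X n) :
    ∃ φ : Fin (n + 1) → X → ℝ, (∀ j, Continuous (φ j)) ∧ (∀ j x, 0 ≤ φ j x) ∧
      (∀ j g x, x ∈ t.src g → φ j x ≠ 0 → φ j (t.map g x) ≠ 0 → g = 1) ∧
      ∀ x, ∑ j, t.orbitSum (φ j) x = 1 := by
  classical
  have hcl := fun g => (hs g).isClosed
  have hop := fun g => (hs g).isOpen
  choose B hBn hBc hBs using t.exists_separated_nhds hfree hcl hm
  obtain ⟨I, hI⟩ := CompactSpace.elim_nhds_subcover (fun x => interior (B x))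
    (fun x => interior_mem_nhds.2 (hBn x))
  set W : I → Set X := fun i => interior (B i)
  have hWo : ∀ i, IsOpen (W i) := fun i => isOpen_interior
  have hWs : ∀ i, t.Separated (W i) := fun x g y hy h1 h2 =>
    hBs x g y hy (interior_subset h1) (interior_subset h2)
  have hIc : ∀ x, ∃ i : I, x ∈ W i := fun x => by
    obtain ⟨i, hi, hx⟩ := mem_iUnion₂.1 (hI.symm ▸ mem_univ x : x ∈ ⋃ x ∈ I, interior (B x))
    exact ⟨⟨i, hi⟩, hx⟩
  rcases isEmpty_or_nonempty X with hX | ⟨⟨x₀⟩⟩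
  · exact ⟨fun _ _ => 0, fun _ => continuous_const, fun _ _ => le_rfl,
      fun _ _ x => hX.elim x, fun x => hX.elim x⟩
  have : Nonempty I := ⟨(hIc x₀).choose⟩
  obtain ⟨V, hVo, hVi, hVW, hVc, hVn⟩ := t.exists_invariant_shrinking hdim hcl hm
    (Finset.univ : Finset I) (fun i => B i) (fun i => hBc i) (fun i => hBs i) (fun i => t.sat (W i))
    (fun i => t.isOpen_sat hop (fun g => (hm g).continuousOn) (hWo i))
    (fun i => t.invariant_sat _) (eq_univ_of_forall fun x => by
      obtain ⟨i, hi⟩ := hIc x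
      exact mem_iUnion.2 ⟨i, t.subset_sat _ hi⟩)
  replace hVn : ∀ x, {i | x ∈ V i}.encard ≤ n + 1 := fun x => by
    obtain ⟨i, hi⟩ := hIc x
    exact hVn i (Finset.mem_univ i) x (t.subset_sat _ (interior_subset hi))
  obtain ⟨p, hp⟩ := PartitionOfUnity.exists_isSubordinate isClosed_univ V hVo hVc.ge
  set P : I → X → ℝ := fun i => t.orbitSum (p i)
  have hP0 : ∀ i x, 0 ≤ P i x := fun i x => t.orbitSum_nonneg (p.nonneg i) x
  have hPc : ∀ i, Continuous (P i) := fun i => t.continuous_orbitSum hs hm (p i).continuous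
  have hPV : ∀ i x, P i x ≠ 0 → x ∈ V i := fun i x hx => by
    obtain ⟨g, hg, hne⟩ := t.exists_of_orbitSum_ne_zero hx
    exact (hVi i g x hg).1 (hp i (subset_tsupport _ hne))
  have hPpos : ∀ x, ∃ i, P i x ≠ 0 := fun x => by
    obtain ⟨i, hi⟩ := p.exists_pos (mem_univ x)
    exact ⟨i, (hi.trans_le (t.le_orbitSum_self (p.nonneg i) x)).ne'⟩
  have hchoice : ∀ S : Finset I, ∃ i, S.Nonempty → i ∈ S := fun S => by
    by_cases hS : S.Nonempty
    · exact ⟨hS.choose, fun _ => hS.choose_spec⟩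
    · exact ⟨Classical.arbitrary I, fun h => absurd h hS⟩
  -- `c` picks a vertex of each cell; its value at the empty set is never used.
  choose c hc using hchoice
  have hcS : ∀ (S : Finset I) (m : ℕ), S.card = m + 1 → c S ∈ S := fun S m h =>
    hc S (Finset.card_pos.1 (by omega))
  -- Colour `s` collects the cells with `s + 1` vertices. On the cell of `S`, the separated set `W
  -- (c S)` selects at most one point from each orbit.
  set ψ : Fin (n + 1) → X → ℝ := fun s x => ∑ S : Finset I with S.card = (s : ℕ) + 1,
    (W (c S)).indicator (dominance P S) x
  have hψ0 : ∀ s x, 0 ≤ ψ s x := fun s x => Finset.sum_nonneg fun S _ =>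
    indicator_nonneg (fun _ _ => dominance_nonneg hP0) _
  have hψc : ∀ s, Continuous (ψ s) := fun s => by
    refine continuous_finsetSum _ fun S hS => continuous_indicator (fun x hx => ?_)
      (continuous_dominance hPc).continuousOn
    -- The indicator can jump only on the frontier of `W (c S)`, which misses its saturation,
    -- whereas `dominance P S` is supported in `V (c S)`, inside that saturation.
    by_contra hne
    exact (hWs (c S)).notMem_sat_of_mem_frontier hop hm (hWo _) hx
      (hVW _ (hPV _ _ (ne_zero_of_dominance_ne_zero hne (hcS S s (Finset.mem_filter.1 hS).2))))
  have hψne : ∀ s x, ψ s x ≠ 0 → ∃ S : Finset I, S.card = s + 1 ∧ x ∈ W (c S) ∧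
      dominance P S x ≠ 0 := fun s x hx => by
    obtain ⟨S, hS, hne⟩ := Finset.exists_ne_zero_of_sum_ne_zero hx
    have hm := mem_of_indicator_ne_zero hne
    exact ⟨S, (Finset.mem_filter.1 hS).2, hm, by rwa [indicator_of_mem hm] at hne⟩
  set T : X → ℝ := fun x => ∑ s, t.orbitSum (ψ s) x
  have hTc : Continuous T := continuous_finsetSum _ fun s _ => t.continuous_orbitSum hs hm (hψc s)
  have hTpos : ∀ x, 0 < T x := fun x => by
    set S : Finset I := {i | P i x ≠ 0} with hSdef
    have hSne : 0 < S.card := Finset.card_pos.2 (by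
      obtain ⟨i, hi⟩ := hPpos x
      exact ⟨i, by simpa [hSdef] using hi⟩)
    have hScard : S.card ≤ n + 1 := by
      have h1 : (S : Set I).encard ≤ n + 1 := le_trans (encard_le_encard fun i hi =>
        hPV i x (by simpa [hSdef] using hi)) (hVn x)
      rw [encard_coe_eq_coe_finsetCard] at h1
      exact_mod_cast h1
    have hcmem := hcS S (S.card - 1) (by omega)
    -- The point `x` need not lie in `W (c S)`, but its orbit meets that set, and the dominance
    -- function is constant along the orbit.
    obtain ⟨g, hg, hgW⟩ := hVW _ (hPV (c S) x (by simpa [hSdef] using hcmem))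
    let s : Fin (n + 1) := ⟨S.card - 1, by omega⟩
    have h1 : 0 < ψ s (t.map g x) := by
      refine lt_of_lt_of_le ?_ (Finset.single_le_sum (f := fun S =>
        (W (c S)).indicator (dominance P S) (t.map g x)) (fun S _ =>
          indicator_nonneg (fun _ _ => dominance_nonneg hP0) _)
          (Finset.mem_filter.2 ⟨Finset.mem_univ S, by simp only [s]; omega⟩))
      simp only [indicator_of_mem hgW]
      rw [t.dominance_map _ _ hg]
      exact dominance_support_pos hP0 x
    calc 0 < ψ s (t.map g x) := h1
      _ ≤ t.orbitSum (ψ s) x := t.le_orbitSum (hψ0 s) hg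
      _ ≤ T x := Finset.single_le_sum (f := fun s => t.orbitSum (ψ s) x)
          (fun s _ => t.orbitSum_nonneg (hψ0 s) x) (Finset.mem_univ s)
  have hTinv : ∀ g x, x ∈ t.src g → T (t.map g x) = T x := fun g x hx => by
    simp only [T, t.orbitSum_map _ hx]
  -- Dividing by `T` normalizes every orbit sum at once, because `T` is positive and constant on
  -- orbits.
  refine ⟨fun s x => ψ s x / T x, fun s => (hψc s).div hTc fun x => (hTpos x).ne',
    fun s x => div_nonneg (hψ0 s x) (hTpos x).le, fun s g x hx h1 h2 => ?_, fun x => ?_⟩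
  · obtain ⟨S, hS, hxS, hne⟩ := hψne s x fun h => h1 (by simp only [h, zero_div])
    obtain ⟨S', hS', hxS', hne'⟩ := hψne s (t.map g x) fun h => h2 (by simp only [h, zero_div])
    rw [t.dominance_map _ _ hx] at hne'
    obtain rfl := eq_of_dominance_ne_zero hne hne' (hS.trans hS'.symm)
    exact hWs _ g x hx hxS hxS'
  · rw [← div_self (hTpos x).ne']
    simp only [T, Finset.sum_div]
    refine Finset.sum_congr rfl fun s _ => ?_
    simp only [orbitSum, Finset.sum_div]
    refine Finset.sum_congr rfl fun g _ => ?_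
    by_cases hg : x ∈ t.src g
    · have := hTinv g x hg
      simp only [T, orbitSum] at this
      simp only [indicator_of_mem hg, this]
    · simp [hg]

end PartialMaps

/-! ### Compactly supported cut-off functions -/

/-- `f` is a continuous function with values in `[0, 1]` and with compact support in `U`. -/
structure IsCutoff {X : Type*} [TopologicalSpace X] (f : X → ℝ) (U : Set X) : Prop where
  continuous : Continuous f
  compact : HasCompactSupport f
  tsupport_subset : tsupport f ⊆ U
  nonneg : ∀ x, 0 ≤ f x
  le_one : ∀ x, f x ≤ 1

section Cutoff

variable {X : Type*} [TopologicalSpace X] {f e : X → ℝ} {U V : Set X}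

theorem IsCutoff.eq_zero (hf : IsCutoff f U) {x : X} (hx : x ∉ U) : f x = 0 :=
  image_eq_zero_of_notMem_tsupport fun h => hx (hf.tsupport_subset h)

theorem isCutoff_zero (U : Set X) : IsCutoff (fun _ => 0) U :=
  ⟨continuous_const, HasCompactSupport.zero, by simp [tsupport], fun _ => le_rfl,
    fun _ => zero_le_one⟩

theorem IsCutoff.mono (hf : IsCutoff f U) (h : U ⊆ V) : IsCutoff f V :=
  ⟨hf.continuous, hf.compact, hf.tsupport_subset.trans h, hf.nonneg, hf.le_one⟩

theorem IsCutoff.mul_left (hf : IsCutoff f U) (he : Continuous e) (h0 : ∀ x, 0 ≤ e x)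
    (h1 : ∀ x, e x ≤ 1) : IsCutoff (fun x => e x * f x) U :=
  ⟨he.mul hf.continuous, hf.compact.mul_left,
    (closure_mono (Function.support_mul_subset_right e f)).trans hf.tsupport_subset,
    fun x => mul_nonneg (h0 x) (hf.nonneg x),
    fun x => mul_le_one₀ (h1 x) (hf.nonneg x) (hf.le_one x)⟩

variable [LocallyCompactSpace X] [T2Space X]

theorem exists_isCutoff {K : Set X} (hK : IsCompact K) (hU : IsOpen U) (hKU : K ⊆ U) :
    ∃ f, IsCutoff f U ∧ ∀ x ∈ K, f x = 1 := by
  obtain ⟨L, hL, hLc, hKL, hLU⟩ := exists_compact_closed_between hK hU hKU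
  obtain ⟨f, h1, h0, hc, hf⟩ := exists_continuous_one_zero_of_isCompact hK
    isOpen_interior.isClosed_compl (disjoint_compl_right_iff_subset.2 hKL)
  refine ⟨f, ⟨f.continuous, hc, ?_, fun x => (hf x).1, fun x => (hf x).2⟩, fun x hx => h1 hx⟩
  refine (closure_minimal (fun x hx => ?_) hLc).trans hLU
  by_contra hxL
  exact hx (h0 fun h => hxL (interior_subset h))

/-- Tietze extension from a compact subset, with control on the support. -/
theorem exists_isCutoff_extension {K Q : Set X} (hK : IsCompact K) (hQ : IsCompact Q)
    (hU : IsOpen U) (hQU : Q ⊆ U) (f : K → ℝ) (hf : Continuous f) (h0 : ∀ z, 0 ≤ f z)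
    (h1 : ∀ z, f z ≤ 1) (hfQ : ∀ z : K, (z : X) ∉ Q → f z = 0) :
    ∃ F, IsCutoff F U ∧ ∀ z : K, F z = f z := by
  have : CompactSpace K := isCompact_iff_compactSpace.1 hK
  obtain ⟨b, hb, hb1⟩ := exists_isCutoff hQ hU hQU
  -- Tietze is applied in the one-point compactification, which is normal; multiplying by `b` then
  -- places the support in `U`.
  have he : IsClosedEmbedding (fun z : K => ((z : X) : OnePoint X)) :=
    (OnePoint.continuous_coe.comp continuous_subtype_val).isClosedEmbedding
      (OnePoint.coe_injective.comp Subtype.val_injective)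
  obtain ⟨g, hg, hgf⟩ :=
    BoundedContinuousFunction.exists_extension_forall_mem_Icc_of_isClosedEmbedding
      (BoundedContinuousFunction.mkOfCompact ⟨f, hf⟩) (fun z => ⟨h0 z, h1 z⟩) zero_le_one he
  refine ⟨fun x => g x * b x, hb.mul_left (g.continuous.comp OnePoint.continuous_coe)
    (fun x => (hg x).1) (fun x => (hg x).2), fun z => ?_⟩
  have hgz : g ((z : X) : OnePoint X) = f z := congrFun hgf z
  simp only [hgz]
  by_cases hz : (z : X) ∈ Q
  · rw [hb1 z hz, mul_one]
  · rw [hfQ z hz, zero_mul]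

end Cutoff

/-! ### Almost invariant cut-off functions -/

namespace PartialMaps

variable {G X : Type*} [Group G] (t : PartialMaps G X) [TopologicalSpace X]

section AlmostInvariant

variable [LocallyCompactSpace X] [T2Space X] [Finite G] {U M : Set X} {C : G → Set X}

/-- This builds a staircase of height `N` whose steps are spread out. Each new summand equals `1` at
both ends of every move along `C` that touches the support of the earlier ones, so any single move
sees at most one step. Rescaling by the height makes the oscillation small. -/
theorem exists_unit_oscillation (hm : ∀ g, ContinuousOn (t.map g) (t.src g)) (hU : IsOpen U)
    (hUi : t.Invariant U) (hM : IsCompact M) (hMU : M ⊆ U) (hC : ∀ g, IsCompact (C g))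
    (hCs : ∀ g, C g ⊆ t.src g) (N : ℕ) :
    ∃ s : X → ℝ, Continuous s ∧ HasCompactSupport s ∧ tsupport s ⊆ U ∧ (∀ x, 0 ≤ s x) ∧
      (∀ x, s x ≤ N) ∧ (∀ x ∈ M, s x = N) ∧ ∀ g, ∀ z ∈ C g, |s z - s (t.map g z)| ≤ 1 := by
  induction N with
  | zero =>
    exact ⟨fun _ => 0, continuous_const, HasCompactSupport.zero, by simp [tsupport],
      fun _ => le_rfl, by simp, by simp, by simp⟩
  | succ N ih =>
    obtain ⟨s, hsc, hs, hsU, hs0, hsN, hsM, hsC⟩ := ih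
    have hCm : ∀ g, ContinuousOn (t.map g) (C g) := fun g => (hm g).mono (hCs g)
    set L : Set X := (M ∪ tsupport s) ∪ ((⋃ g, t.map g '' (C g ∩ tsupport s)) ∪
      ⋃ g, C g ∩ t.map g ⁻¹' tsupport s) with hL
    have hLc : IsCompact L := by
      refine (hM.union hs).union ((isCompact_iUnion fun g => ?_).union
        (isCompact_iUnion fun g => ?_))
      · exact ((hC g).inter_right (isClosed_tsupport s)).image_of_continuousOn
          ((hCm g).mono inter_subset_left)
      · exact (hC g).of_isClosed_subset ((hCm g).preimage_isClosed_of_isClosed (hC g).isClosed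
          (isClosed_tsupport s)) inter_subset_left
    have hLU : L ⊆ U := by
      refine union_subset (union_subset hMU hsU) (union_subset (iUnion_subset fun g => ?_)
        (iUnion_subset fun g => ?_))
      · rintro _ ⟨x, hx, rfl⟩
        exact (hUi g x (hCs g hx.1)).2 (hsU hx.2)
      · exact fun x hx => (hUi g x (hCs g hx.1)).1 (hsU hx.2)
    obtain ⟨e, he, he1⟩ := exists_isCutoff hLc hU hLU
    refine ⟨s + e, hsc.add he.continuous, hs.add he.compact,
      (tsupport_add s e).trans (union_subset hsU he.tsupport_subset),
      fun x => add_nonneg (hs0 x) (he.nonneg x), fun x => ?_, fun x hx => ?_, fun g z hz => ?_⟩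
    · push_cast
      exact add_le_add (hsN x) (he.le_one x)
    · simp [hsM x hx, he1 x (Or.inl (Or.inl hx))]
    · simp only [Pi.add_apply]
      by_cases hzs : z ∈ tsupport s
      · rw [he1 z (Or.inl (Or.inr hzs)),
          he1 _ (Or.inr (Or.inl (mem_iUnion.2 ⟨g, z, ⟨hz, hzs⟩, rfl⟩)))]
        simpa using hsC g z hz
      by_cases hys : t.map g z ∈ tsupport s
      · rw [he1 _ (Or.inl (Or.inr hys)),
          he1 z (Or.inr (Or.inr (mem_iUnion.2 ⟨g, hz, hys⟩)))]
        simpa using hsC g z hz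
      rw [image_eq_zero_of_notMem_tsupport hzs, image_eq_zero_of_notMem_tsupport hys, abs_le]
      have := he.nonneg z
      have := he.nonneg (t.map g z)
      have := he.le_one z
      have := he.le_one (t.map g z)
      constructor <;> linarith

/-- Compact subsets of invariant open sets admit almost invariant cut-off functions. -/
theorem exists_almost_invariant_cutoff (hm : ∀ g, ContinuousOn (t.map g) (t.src g))
    (hU : IsOpen U) (hUi : t.Invariant U) (hM : IsCompact M) (hMU : M ⊆ U)
    (hC : ∀ g, IsCompact (C g)) (hCs : ∀ g, C g ⊆ t.src g) {δ : ℝ} (hδ : 0 < δ) :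
    ∃ e, IsCutoff e U ∧ (∀ x ∈ M, e x = 1) ∧ ∀ g, ∀ z ∈ C g, |e z - e (t.map g z)| ≤ δ := by
  obtain ⟨N, hN⟩ := exists_nat_one_div_lt hδ
  obtain ⟨s, hsc, hs, hsU, hs0, hsN, hsM, hsC⟩ :=
    t.exists_unit_oscillation hm hU hUi hM hMU hC hCs (N + 1)
  push_cast at hsN hsM
  have hN0 : (0 : ℝ) < N + 1 := by positivity
  refine ⟨fun x => 1 / (N + 1) * s x, ⟨by fun_prop, hs.mul_left,
    (closure_mono (Function.support_mul_subset_right _ s)).trans hsU,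
    fun x => mul_nonneg (by positivity) (hs0 x), fun x => ?_⟩, fun x hx => ?_, fun g z hz => ?_⟩
  · rw [one_div, inv_mul_le_one₀ hN0]
    exact hsN x
  · simp only [hsM x hx]
    rw [one_div_mul_cancel hN0.ne']
  · rw [← mul_sub, abs_mul, abs_of_pos (by positivity : (0 : ℝ) < 1 / (N + 1))]
    exact (mul_le_of_le_one_right (by positivity) (hsC g z hz)).trans hN.le

end AlmostInvariant

/-! ### Approximate towers and gluing across an invariant open set -/

variable [Fintype G]

/-- Rokhlin towers of functions supported in `U` that are approximately equivariant along `C`,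
orthogonal on `K` and sum up to one on `K`, up to `δ`. -/
structure IsTowers (U K : Set X) (C : G → Set X) (δ : ℝ) {ι : Type*} [Fintype ι]
    (f : ι → G → X → ℝ) : Prop where
  isCutoff : ∀ j g, IsCutoff (f j g) (U ∩ t.src g⁻¹)
  sum_one : ∀ x ∈ K, |∑ j, ∑ g, f j g x - 1| ≤ δ
  orthogonal : ∀ j g h, g ≠ h → ∀ x ∈ K, f j g x * f j h x ≤ δ
  equivariant : ∀ j g h, ∀ x ∈ C g, x ∈ K → t.map g x ∈ K →
    |f j h x - f j (g * h) (t.map g x)| ≤ δ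

/-- There are approximate Rokhlin towers over `U`, indexed by `ι`. -/
def HasTowers (U : Set X) (ι : Type*) [Fintype ι] : Prop :=
  ∀ K ⊆ U, IsCompact K → ∀ C : G → Set X, (∀ g, IsCompact (C g)) → (∀ g, C g ⊆ t.src g) →
    ∀ δ > 0, ∃ f : ι → G → X → ℝ, t.IsTowers U K C δ f

/-- There are functions supported in `U`, indexed by `ι`, that form exact Rokhlin towers on
compact pieces of `Y`. -/
def HasExactTowers (U Y : Set X) (ι : Type*) [Fintype ι] : Prop :=
  ∀ K ⊆ U, IsCompact K → ∃ f : ι → G → X → ℝ, t.IsTowers U (K ∩ Y) t.src 0 f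

variable {t} {U U' : Set X} {ι κ : Type*} [Fintype ι] [Fintype κ]

theorem HasTowers.congr (h : t.HasTowers U ι) (e : ι ≃ κ) : t.HasTowers U κ := by
  intro K hKU hK C hC hCs δ hδ
  obtain ⟨f, hf⟩ := h K hKU hK C hC hCs δ hδ
  refine ⟨fun j => f (e.symm j), fun j => hf.1 _, fun x hx => ?_, fun j => hf.3 _,
    fun j => hf.4 _⟩
  rw [Equiv.sum_comp e.symm fun j => ∑ g, f j g x]
  exact hf.2 x hx

theorem hasTowers_empty [IsEmpty ι] : t.HasTowers ∅ ι := by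
  intro K hK _ C _ _ δ _
  exact ⟨fun j => isEmptyElim j, fun j => isEmptyElim j, fun x hx => (hK hx).elim,
    fun j => isEmptyElim j, fun j => isEmptyElim j⟩

theorem abs_mul_sub_mul_le {a b c d δ : ℝ} (h : |a - b| ≤ δ)
    (hd : 0 ≤ d) (hd1 : d ≤ 1) (hcd : |a * (c - d)| ≤ δ) : |a * c - b * d| ≤ 2 * δ := by
  have h1 : a * c - b * d = a * (c - d) + (a - b) * d := by ring
  have h2 : |(a - b) * d| ≤ δ := by
    rw [abs_mul, abs_of_nonneg hd]
    exact (mul_le_of_le_one_right (abs_nonneg _) hd1).trans h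
  rw [h1]
  exact (abs_add_le _ _).trans (by linarith)

/-- Towers over an invariant open set can be extended by exact towers over its complement. -/
theorem HasTowers.extend [LocallyCompactSpace X] [T2Space X]
    (hm : ∀ g, ContinuousOn (t.map g) (t.src g)) (hU : IsOpen U) (hUi : t.Invariant U)
    (hUU' : U ⊆ U') (h : t.HasTowers U κ) (hY : t.HasExactTowers U' (U' \ U) ι) :
    t.HasTowers U' (ι ⊕ κ) := by
  intro K hKU hK C hC hCs ε hε
  obtain ⟨f', hf'⟩ := hY K hKU hK
  set δ := ε / 4 with hδdef
  have hδ : 0 < δ := by positivity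
  have hc' : ∀ j g, Continuous (f' j g) := fun j g => (hf'.isCutoff j g).continuous
  set D : G → Set X := fun g => (C g ∩ t.map g ⁻¹' K) ∩ K with hD
  have hDc : ∀ g, IsCompact (D g) := fun g => ((hC g).of_isClosed_subset
    (((hm g).mono (hCs g)).preimage_isClosed_of_isClosed (hC g).isClosed hK.isClosed)
      inter_subset_left).inter_right hK.isClosed
  have hDC : ∀ g, D g ⊆ C g := fun g x hx => hx.1.1
  -- `M` collects the points of `K` where some tower condition for `f'` fails by at least `δ`. It is
  -- compact, and it lies in `U` because `f'` is exact on `K \ U`.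
  set M : Set X := (K ∩ {x | δ ≤ |∑ j, ∑ g, f' j g x - 1|}) ∪
    ((⋃ p : ι × {q : G × G // q.1 ≠ q.2}, K ∩ {x | δ ≤ f' p.1 p.2.1.1 x * f' p.1 p.2.1.2 x}) ∪
    ⋃ p : ι × G × G, D p.2.1 ∩
      (fun x => |f' p.1 p.2.2 x - f' p.1 (p.2.1 * p.2.2) (t.map p.2.1 x)|) ⁻¹' Ici δ) with hM
  have hMc : IsCompact M := by
    refine (hK.inter_right (isClosed_le continuous_const ?_)).union
      ((isCompact_iUnion fun p => hK.inter_right (isClosed_le continuous_const ?_)).union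
        (isCompact_iUnion fun p => ?_))
    · fun_prop
    · exact (hc' _ _).mul (hc' _ _)
    · refine (hDc _).of_isClosed_subset (ContinuousOn.preimage_isClosed_of_isClosed ?_
        (hDc _).isClosed isClosed_Ici) inter_subset_left
      exact ((hc' _ _).continuousOn.sub ((hc' _ _).comp_continuousOn
        ((hm _).mono ((hDC _).trans (hCs _))))).abs
  have hMU : M ⊆ U := by
    intro x hx
    by_contra hxU
    rcases hx with ⟨hxK, hx⟩ | hx | hx
    · exact absurd (hf'.sum_one x ⟨hxK, hKU hxK, hxU⟩) (not_le.2 (hδ.trans_le hx))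
    · obtain ⟨⟨j, q, hq⟩, hxK, hx⟩ := mem_iUnion.1 hx
      exact absurd (hf'.orthogonal j _ _ hq x ⟨hxK, hKU hxK, hxU⟩) (not_le.2 (hδ.trans_le hx))
    · obtain ⟨⟨j, g, k⟩, ⟨⟨hxC, hxg⟩, hxK⟩, hx⟩ := mem_iUnion.1 hx
      exact absurd (hf'.equivariant j g k x (hCs g hxC) ⟨hxK, hKU hxK, hxU⟩
        ⟨hxg, hKU hxg, fun h => hxU ((hUi g x (hCs g hxC)).1 h)⟩) (not_le.2 (hδ.trans_le hx))
  obtain ⟨e, he, he1, heC⟩ :=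
    t.exists_almost_invariant_cutoff hm hU hUi hMc hMU hC hCs hδ
  -- Errors of `f` matter only on the support of `e`, and errors of `f'` only where `e ≠ 1`, hence
  -- off `M`.
  obtain ⟨f, hf⟩ := h (tsupport e) he.tsupport_subset he.compact C hC hCs δ hδ
  have hout : ∀ {x a}, (x ∉ M → |a| ≤ δ) → |(1 - e x) * a| ≤ δ := fun {x a} hx => by
    by_cases hxM : x ∈ M
    · simp [he1 x hxM, hδ.le]
    · rw [abs_mul, abs_of_nonneg (sub_nonneg.2 (he.le_one x))]
      exact (mul_le_of_le_one_left (abs_nonneg _) (by linarith [he.nonneg x])).trans (hx hxM)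
  have hin : ∀ {x a}, (x ∈ tsupport e → |a| ≤ δ) → |e x * a| ≤ δ := fun {x a} hx => by
    by_cases hxe : x ∈ tsupport e
    · rw [abs_mul, abs_of_nonneg (he.nonneg x)]
      exact (mul_le_of_le_one_left (abs_nonneg _) (he.le_one x)).trans (hx hxe)
    · simp [image_eq_zero_of_notMem_tsupport hxe, hδ.le]
  refine ⟨Sum.elim (fun j g x => (1 - e x) * f' j g x) (fun j g x => e x * f j g x),
    ?_, fun x hx => ?_, ?_, ?_⟩
  · rintro (j | j) g
    · exact (hf'.isCutoff j g).mul_left (by have := he.continuous; fun_prop)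
        (fun x => sub_nonneg.2 (he.le_one x)) fun x => by linarith [he.nonneg x]
    · exact ((hf.isCutoff j g).mul_left he.continuous he.nonneg he.le_one).mono
        (inter_subset_inter_left _ hUU')
  · simp only [Fintype.sum_sum_type, Sum.elim_inl, Sum.elim_inr, ← Finset.mul_sum]
    have h1 : |(1 - e x) * (∑ j, ∑ g, f' j g x - 1)| ≤ δ := hout fun hxM => by
      by_contra hlt
      exact hxM (Or.inl ⟨hx, (not_le.1 hlt).le⟩)
    have h2 : |e x * (∑ j, ∑ g, f j g x - 1)| ≤ δ := hin fun hxe => hf.sum_one x hxe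
    have h3 : (1 - e x) * ∑ j, ∑ g, f' j g x + e x * ∑ j, ∑ g, f j g x - 1 =
      (1 - e x) * (∑ j, ∑ g, f' j g x - 1) + e x * (∑ j, ∑ g, f j g x - 1) := by ring
    rw [h3]
    exact (abs_add_le _ _).trans (by linarith)
  · rintro (j | j) g k hgk x hx
    · have h1 : |(1 - e x) * (f' j g x * f' j k x)| ≤ δ := hout fun hxM => by
        by_contra hlt
        rw [abs_of_nonneg (mul_nonneg ((hf'.isCutoff _ _).nonneg _)
          ((hf'.isCutoff _ _).nonneg _))] at hlt
        exact hxM (Or.inr (Or.inl (mem_iUnion.2 ⟨(j, ⟨(g, k), hgk⟩), hx, (not_le.1 hlt).le⟩)))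
      have h2 := (le_abs_self _).trans h1
      have h3 := (hf'.isCutoff j g).nonneg x
      have h4 := (hf'.isCutoff j k).nonneg x
      have h5 := he.nonneg x
      have h6 := he.le_one x
      calc (1 - e x) * f' j g x * ((1 - e x) * f' j k x)
          = (1 - e x) * ((1 - e x) * (f' j g x * f' j k x)) := by ring
        _ ≤ 1 * ((1 - e x) * (f' j g x * f' j k x)) :=
          mul_le_mul_of_nonneg_right (by linarith)
            (mul_nonneg (by linarith) (mul_nonneg h3 h4))
        _ ≤ ε := by linarith
    · have h1 : |e x * (f j g x * f j k x)| ≤ δ := hin fun hxe => by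
        rw [abs_of_nonneg (mul_nonneg ((hf.isCutoff _ _).nonneg _) ((hf.isCutoff _ _).nonneg _))]
        exact hf.orthogonal j g k hgk x hxe
      have h2 := (le_abs_self _).trans h1
      have h3 := (hf.isCutoff j g).nonneg x
      have h4 := (hf.isCutoff j k).nonneg x
      have h5 := he.nonneg x
      have h6 := he.le_one x
      calc e x * f j g x * (e x * f j k x) = e x * (e x * (f j g x * f j k x)) := by ring
        _ ≤ 1 * (e x * (f j g x * f j k x)) :=
          mul_le_mul_of_nonneg_right h6 (mul_nonneg h5 (mul_nonneg h3 h4))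
        _ ≤ ε := by linarith
  · have hε2 : 2 * δ ≤ ε := by linarith
    rintro (j | j) g k x hxC hxK hyK
    · refine le_trans (abs_mul_sub_mul_le (δ := δ) ?_ ((hf'.isCutoff _ _).nonneg _)
        ((hf'.isCutoff _ _).le_one _) (hout fun hxM => ?_)) hε2
      · rw [abs_sub_comm]
        convert heC g x hxC using 2
        ring
      · by_contra hlt
        exact hxM (Or.inr (Or.inr (mem_iUnion.2
          ⟨(j, g, k), ⟨⟨hxC, hyK⟩, hxK⟩, (not_le.1 hlt).le⟩)))
    · by_cases hye : t.map g x ∈ tsupport e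
      · exact le_trans (abs_mul_sub_mul_le (heC g x hxC)
          ((hf.isCutoff _ _).nonneg _) ((hf.isCutoff _ _).le_one _)
          (hin fun hxe => hf.equivariant j g k x hxC hxe hye)) hε2
      -- The image is outside the support of `e`, so the equivariance of `f` is not available; but
      -- almost invariance then gives `e x ≤ δ`, which suffices.
      · have h1 := heC g x hxC
        rw [image_eq_zero_of_notMem_tsupport hye, sub_zero] at h1
        simp only [Sum.elim_inr, image_eq_zero_of_notMem_tsupport hye, zero_mul, sub_zero]
        rw [abs_mul, abs_of_nonneg ((hf.isCutoff j k).nonneg x)]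
        exact (mul_le_of_le_one_right (abs_nonneg _) ((hf.isCutoff j k).le_one x)).trans
          (by linarith)

end PartialMaps

/-! ### Restriction to invariant subsets -/

namespace PartialMaps

variable {G X : Type*} [Group G] (t : PartialMaps G X)

open Classical in
/-- The restriction of a partial action to an invariant subset. -/
noncomputable def restrict {C : Set X} (hC : t.Invariant C) : PartialMaps G C where
  src g := {z | (z : X) ∈ t.src g}
  map g z := if h : (z : X) ∈ t.src g then ⟨t.map g z, (hC g z h).2 z.2⟩ else z
  src_one := eq_univ_of_forall fun z => t.mem_src_one z
  map_one z := Subtype.ext (by simp [t.mem_src_one, t.map_one])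
  map_mem g z hz := by
    have hz' : (z : X) ∈ t.src g := hz
    simpa [hz'] using t.map_mem g z hz
  mul_mem g h z hz hgz := by
    have hz' : (z : X) ∈ t.src h := hz
    simp only [hz', dite_true, mem_ofPred_eq] at hgz
    exact t.mul_mem g h z hz hgz
  map_mul g h z hz hgz := by
    have hz' : (z : X) ∈ t.src h := hz
    simp only [hz', dite_true, mem_ofPred_eq] at hgz
    have := t.mul_mem g h z hz hgz
    apply Subtype.ext
    simp [hz', hgz, this, t.map_mul g h z hz hgz]

variable {t}

theorem mem_src_restrict {C : Set X} {hC : t.Invariant C} {g : G} {z : C} :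
    z ∈ (t.restrict hC).src g ↔ (z : X) ∈ t.src g := Iff.rfl

theorem coe_restrict_map {C : Set X} {hC : t.Invariant C} {g : G} {z : C}
    (hz : (z : X) ∈ t.src g) : ((t.restrict hC).map g z : X) = t.map g z := by
  simp [restrict, hz]

theorem IsFree.restrict {C : Set X} (hC : t.Invariant C) (h : t.IsFree) :
    (t.restrict hC).IsFree := fun g z hz hgz =>
  h g z hz (by rw [← coe_restrict_map (hC := hC) hz, hgz])

/-- Extension by the identity is continuous because the domain is clopen in `C`. -/
theorem continuous_restrict_map [TopologicalSpace X] {C : Set X} (hC : t.Invariant C) {g : G}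
    (hm : ContinuousOn (t.map g) (t.src g)) (hs : IsClopen ((t.restrict hC).src g)) :
    Continuous ((t.restrict hC).map g) := by
  classical
  have : (fun z => ((t.restrict hC).map g z : X)) =
      ((t.restrict hC).src g).piecewise (fun z => t.map g z) Subtype.val := by
    ext z
    by_cases hz : z ∈ (t.restrict hC).src g
    · rw [piecewise_eq_of_mem _ _ _ hz, coe_restrict_map hz]
    · rw [piecewise_eq_of_notMem _ _ _ hz]
      rw [mem_src_restrict] at hz
      simp [PartialMaps.restrict, hz]
  refine continuous_induced_rng.2 ?_
  change Continuous fun z => ((t.restrict hC).map g z : X)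
  rw [this]
  refine continuous_piecewise (fun z hz => ?_) ?_ continuous_subtype_val.continuousOn
  · rw [hs.frontier_eq] at hz
    exact hz.elim
  · rw [hs.isClosed.closure_eq]
    exact hm.comp continuous_subtype_val.continuousOn fun z hz => hz

/-! ### Layers by the number of applicable group elements -/

variable [Fintype G]

open Classical in
variable (t) in
/-- The number of elements of the group that can be applied to `x`. -/
noncomputable def numSrc (x : X) : ℕ := (Finset.univ.filter fun g => x ∈ t.src g).card

theorem numSrc_map {h : G} {x : X} (hx : x ∈ t.src h) : t.numSrc (t.map h x) = t.numSrc x := by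
  classical
  refine Finset.card_equiv (Equiv.mulRight h) fun g => ?_
  simp [t.map_mem_src_iff hx]

theorem numSrc_pos (x : X) : 1 ≤ t.numSrc x := by
  classical
  exact Finset.card_pos.2 ⟨1, by simp [t.mem_src_one]⟩

theorem numSrc_le (x : X) : t.numSrc x ≤ Fintype.card G := Finset.card_le_univ _

theorem eq_one_of_numSrc_eq_one {x : X} (h : t.numSrc x = 1) {g : G} (hg : x ∈ t.src g) :
    g = 1 := by
  classical
  obtain ⟨k, hk⟩ := Finset.card_eq_one.1 h
  have h1 : g ∈ ({k} : Finset G) := hk ▸ by simp [hg]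
  have h2 : (1 : G) ∈ ({k} : Finset G) := hk ▸ by simp [t.mem_src_one]
  rw [Finset.mem_singleton] at h1 h2
  rw [h1, h2]

variable (t) in
/-- The points to which at least `k` elements of the group can be applied. -/
def layerGE (k : ℕ) : Set X := {x | k ≤ t.numSrc x}

theorem invariant_layerGE (k : ℕ) : t.Invariant (t.layerGE k) := fun g x hx => by
  simp [layerGE, numSrc_map hx]

theorem layerGE_diff_succ (k : ℕ) : t.layerGE k \ t.layerGE (k + 1) = {x | t.numSrc x = k} := by
  ext x
  simp only [layerGE, Set.mem_sdiff, mem_ofPred_eq]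
  omega

variable [TopologicalSpace X]

omit [Fintype G] in
theorem isOpen_setOf_le_card (ho : ∀ g, IsOpen (t.src g)) (s : Finset G) (k : ℕ) :
    IsOpen {x | ∃ T ⊆ s, k ≤ T.card ∧ ∀ g ∈ T, x ∈ t.src g} := by
  have : {x | ∃ T ⊆ s, k ≤ T.card ∧ ∀ g ∈ T, x ∈ t.src g} =
      ⋃ T ∈ {T : Finset G | T ⊆ s ∧ k ≤ T.card}, ⋂ g ∈ T, t.src g := by
    ext x
    simp [and_assoc]
  rw [this]
  exact isOpen_biUnion fun T _ => isOpen_biInter_finset fun g _ => ho g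

theorem isOpen_layerGE (ho : ∀ g, IsOpen (t.src g)) (k : ℕ) : IsOpen (t.layerGE k) := by
  classical
  convert isOpen_setOf_le_card ho Finset.univ k using 1
  ext x
  refine ⟨fun hx => ⟨_, Finset.subset_univ _, hx, by simp⟩, ?_⟩
  rintro ⟨T, -, hk, hT⟩
  exact hk.trans (Finset.card_le_card fun g hg => by simpa using hT g hg)

/-- Within the points to which exactly `k` elements can be applied, the domains are closed. -/
theorem exists_isOpen_compl_src (ho : ∀ g, IsOpen (t.src g)) (k : ℕ) (g : G) :
    ∃ E, IsOpen E ∧ ∀ x, t.numSrc x = k → (x ∈ E ↔ x ∉ t.src g) := by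
  classical
  -- `E` consists of the points at which at least `k` elements other than `g` apply. When exactly
  -- `k` elements apply in all, this means that `g` is not one of them.
  refine ⟨_, isOpen_setOf_le_card ho (Finset.univ.erase g) k, fun x hx => ⟨?_, fun hg => ?_⟩⟩
  · rintro ⟨T, hT, hk, hTx⟩ hg
    have hgT : g ∉ T := fun h => by simpa using hT h
    have : (insert g T).card ≤ t.numSrc x := Finset.card_le_card fun h hh => by
      rcases Finset.mem_insert.1 hh with rfl | hh
      · simpa using hg
      · simpa using hTx h hh
    rw [Finset.card_insert_of_notMem hgT] at this
    omega
  · refine ⟨_, fun h hh => ?_, hx.ge, by simp⟩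
    simp only [Finset.mem_filter, Finset.mem_univ, true_and] at hh
    exact Finset.mem_erase.2 ⟨fun h0 => hg (h0 ▸ hh), Finset.mem_univ _⟩

variable [LocallyCompactSpace X] [T2Space X]

/-- Only the identity acts on this layer, so a single cut-off placed at `g = 1` is a full tower,
whatever the dimension. -/
theorem hasExactTowers_one :
    t.HasExactTowers univ {x | t.numSrc x = 1} (Fin 1) := by
  classical
  intro K _ hK
  obtain ⟨b, hb, hb1⟩ := exists_isCutoff hK isOpen_univ (subset_univ K)
  refine ⟨fun _ g => if g = 1 then b else fun _ => 0, fun j g => ?_, fun x hx => ?_,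
    fun j g h hgh x hx => ?_, fun j g h x hxg hx _ => ?_⟩
  · split_ifs with h
    · rw [h, inv_one, t.src_one, inter_univ]
      exact hb
    · exact isCutoff_zero _
  · simp [ite_apply, hb1 x hx.1]
  · simp only [ite_apply]
    split_ifs <;> simp_all
  · obtain rfl := eq_one_of_numSrc_eq_one hx.2 hxg
    simp [t.map_one]

/-- The part of `K` in the layer has compact saturation, as domains are relatively clopen in the
layer. Exact towers exist on that saturation and are extended to `X` by Tietze. -/
theorem hasExactTowers_layer (hfree : t.IsFree) (ho : ∀ g, IsOpen (t.src g))
    (hm : ∀ g, ContinuousOn (t.map g) (t.src g)) {n : ℕ} (hdim : CoveringDimLE X n) (k : ℕ) :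
    t.HasExactTowers (t.layerGE k) {x | t.numSrc x = k} (Fin (n + 1)) := by
  classical
  intro K hKU hK
  choose E hEo hE using exists_isOpen_compl_src ho k
  have hcompact : ∀ L : Set X, IsCompact L → (∀ x ∈ L, t.numSrc x = k) → ∀ g,
      IsCompact (L ∩ t.src g) := fun L hL hLk g => by
    have : L ∩ t.src g = L \ E g := by
      ext x
      refine and_congr_right fun hx => ?_
      rw [hE g x (hLk x hx), not_not]
    rw [this]
    exact hL.diff (hEo g)
  set K₀ := K ∩ {x | t.numSrc x = k} with hK₀
  have hK₀c : IsCompact K₀ := by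
    -- Compactness uses `K ⊆ t.layerGE k`: within `K` the layer is cut out by removing an open set.
    have : K₀ = K \ t.layerGE (k + 1) := by
      ext x
      refine and_congr_right fun hx => ?_
      have : k ≤ t.numSrc x := hKU hx
      simp only [mem_ofPred_eq, layerGE]
      omega
    rw [this]
    exact hK.diff (isOpen_layerGE ho _)
  have hKinv := t.invariant_sat K₀
  have hsat : t.sat K₀ = ⋃ g, t.map g '' (K₀ ∩ t.src g) := by
    ext x
    simp only [sat, mem_ofPred_eq, mem_iUnion, mem_image]
    constructor
    · rintro ⟨g, hg, hgK⟩
      exact ⟨g⁻¹, t.map g x, ⟨hgK, t.map_mem g x hg⟩, t.map_inv_map hg⟩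
    · rintro ⟨g, y, ⟨hy, hyg⟩, rfl⟩
      exact ⟨g⁻¹, t.map_mem g y hyg, by rwa [t.map_inv_map hyg]⟩
  have hZc : IsCompact (t.sat K₀) := by
    rw [hsat]
    exact isCompact_iUnion fun g => (hcompact K₀ hK₀c (fun x hx => hx.2) g).image_of_continuousOn
      ((hm g).mono inter_subset_right)
  have hZk : ∀ x ∈ t.sat K₀, t.numSrc x = k := by
    rintro x ⟨g, hg, hgK⟩
    rw [← numSrc_map hg]
    exact hgK.2
  have : CompactSpace (t.sat K₀) := isCompact_iff_compactSpace.1 hZc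
  set r := t.restrict hKinv with hr
  have hrs : ∀ g, IsClopen (r.src g) := fun g => by
    refine ⟨isOpen_compl_iff.1 ?_, (ho g).preimage continuous_subtype_val⟩
    convert (hEo g).preimage (continuous_subtype_val : Continuous ((↑) : t.sat K₀ → X)) using 1
    ext z
    exact (hE g z (hZk z z.2)).symm
  have hrm : ∀ g, Continuous (r.map g) := fun g => continuous_restrict_map hKinv (hm g) (hrs g)
  obtain ⟨φ, hφc, hφ0, hφo, hφs⟩ := r.exists_exact_towers (hfree.restrict hKinv) hrs hrm
    (hdim.of_isClosedEmbedding hZc.isClosed.isClosedEmbedding_subtypeVal)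
  have hφ1 : ∀ j x, φ j x ≤ 1 := fun j x => by
    rw [← hφs x]
    exact (r.le_orbitSum_self (hφ0 j) x).trans (Finset.single_le_sum
      (f := fun j => r.orbitSum (φ j) x) (fun j _ => r.orbitSum_nonneg (hφ0 j) x)
      (Finset.mem_univ j))
  -- Translating `φ j` by `g` makes equivariance exact. The sum over `g` is the orbit sum of `φ j`
  -- after `g ↦ g⁻¹`, and orthogonality is the separatedness of its support.
  set f : Fin (n + 1) → G → t.sat K₀ → ℝ := fun j g =>
    (r.src g⁻¹).indicator fun z => φ j (r.map g⁻¹ z) with hf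
  have hf1 : ∀ j g z, f j g z ≤ 1 := fun j g z => by
    simp only [hf, indicator_apply]
    split_ifs
    exacts [hφ1 _ _, zero_le_one]
  have hext : ∀ j g, ∃ F, IsCutoff F (t.layerGE k ∩ t.src g⁻¹) ∧ ∀ z : t.sat K₀, F z = f j g z := by
    intro j g
    refine exists_isCutoff_extension hZc (hcompact _ hZc hZk g⁻¹)
      ((isOpen_layerGE ho k).inter (ho g⁻¹))
      (inter_subset_inter_left _ fun x hx => (hZk x hx).ge) (f j g) ?_
      (fun z => indicator_nonneg (fun _ _ => hφ0 _ _) _)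
      (hf1 j g) fun z hz => ?_
    · exact continuous_indicator (fun a ha => by rw [(hrs _).frontier_eq] at ha; exact ha.elim)
        ((hφc j).comp (hrm _)).continuousOn
    · exact indicator_of_notMem (s := r.src g⁻¹) (fun h => hz ⟨z.2, h⟩) _
  choose F hF hFf using hext
  refine ⟨F, hF, fun x hx => ?_, fun j g h hgh x hx => ?_, fun j g h x hxg hx _ => ?_⟩
  · have hz := hφs ⟨x, t.subset_sat _ hx⟩
    have : ∑ j, ∑ g, F j g x = 1 := by
      rw [← hz]
      refine Finset.sum_congr rfl fun j _ => ?_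
      refine Fintype.sum_equiv (Equiv.inv G) _ _ fun g => ?_
      exact hFf j g ⟨x, t.subset_sat _ hx⟩
    simp [this]
  · set z : t.sat K₀ := ⟨x, t.subset_sat _ hx⟩
    refine le_of_eq ?_
    rw [show F j g x = _ from hFf j g z, show F j h x = _ from hFf j h z]
    by_contra hne
    have h1 := left_ne_zero_of_mul hne
    have h2 := right_ne_zero_of_mul hne
    have hg := mem_of_indicator_ne_zero h1
    have hh := mem_of_indicator_ne_zero h2
    simp only [hf, indicator_of_mem hg, indicator_of_mem hh] at h1 h2
    obtain ⟨h3, h4⟩ := r.map_div_map hh hg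
    rw [← h4] at h2
    have := hφo j _ _ h3 h1 h2
    rw [inv_inv, inv_mul_eq_one] at this
    exact hgh this.symm
  · set z : t.sat K₀ := ⟨x, t.subset_sat _ hx⟩ with hz
    have hzg : z ∈ r.src g := hxg
    have h1 : t.map g x = (r.map g z : X) := (coe_restrict_map (z := z) hxg).symm
    rw [show F j h x = _ from hFf j h z, h1, hFf j (g * h)]
    have h2 : r.map g z ∈ r.src (g * h)⁻¹ ↔ z ∈ r.src h⁻¹ := by
      rw [r.map_mem_src_iff hzg, mul_inv_rev, inv_mul_cancel_right]
    refine le_of_eq (abs_eq_zero.2 (sub_eq_zero.2 ?_))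
    by_cases hzh : z ∈ r.src h⁻¹
    · simp only [hf, indicator_of_mem hzh, indicator_of_mem (h2.2 hzh)]
      rw [r.map_map hzg (by rwa [mul_inv_rev, inv_mul_cancel_right]), mul_inv_rev,
        inv_mul_cancel_right]
    · simp only [hf, indicator_of_notMem hzh, indicator_of_notMem (mt h2.1 hzh)]

/-- Here `i` counts the top layers already treated. For `i = 0` the threshold is `|G| + 1`, which no
point reaches, and no towers are needed. -/
theorem hasTowers_layerGE (hfree : t.IsFree) (ho : ∀ g, IsOpen (t.src g))
    (hm : ∀ g, ContinuousOn (t.map g) (t.src g)) {n : ℕ} (hdim : CoveringDimLE X n) (i : ℕ)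
    (hi : i ≤ Fintype.card G) :
    t.HasTowers (t.layerGE (Fintype.card G + 1 - i)) (Fin (i * (n + 1))) := by
  induction i with
  | zero =>
    have : t.layerGE (Fintype.card G + 1 - 0) = ∅ := by
      refine eq_empty_of_forall_notMem fun x hx => ?_
      have h1 : Fintype.card G + 1 - 0 ≤ t.numSrc x := hx
      have := numSrc_le (t := t) x
      omega
    rw [this]
    have : IsEmpty (Fin (0 * (n + 1))) := by
      rw [Nat.zero_mul]
      infer_instance
    exact hasTowers_empty
  | succ i ih =>
    have hk : Fintype.card G + 1 - i = (Fintype.card G + 1 - (i + 1)) + 1 := by omega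
    have ih := ih (by omega)
    rw [hk] at ih
    have hY := hasExactTowers_layer hfree ho hm hdim (Fintype.card G + 1 - (i + 1))
    rw [← layerGE_diff_succ] at hY
    refine (ih.extend hm (isOpen_layerGE ho _) (invariant_layerGE _) ?_ hY).congr
      (finSumFinEquiv.trans (finCongr (by ring)))
    intro x hx
    have : _ ≤ t.numSrc x := hx
    exact (Nat.le_succ _).trans this

/-- The induction stops at threshold `2`, after `|G| - 1` layers; the remaining layer adds only one
tower. -/
theorem hasTowers_univ (hfree : t.IsFree) (ho : ∀ g, IsOpen (t.src g))
    (hm : ∀ g, ContinuousOn (t.map g) (t.src g)) {n : ℕ} (hdim : CoveringDimLE X n) :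
    t.HasTowers univ (Fin ((Fintype.card G - 1) * (n + 1) + 1)) := by
  have hG := Fintype.card_pos (α := G)
  have h := hasTowers_layerGE hfree ho hm hdim (Fintype.card G - 1) (by omega)
  have h2 : Fintype.card G + 1 - (Fintype.card G - 1) = 1 + 1 := by omega
  rw [h2] at h
  have h1 : t.layerGE 1 = univ := eq_univ_of_forall fun x => numSrc_pos x
  have hY := hasExactTowers_one (t := t)
  rw [← layerGE_diff_succ, ← h1] at hY
  rw [← h1]
  refine (h.extend hm (isOpen_layerGE ho _) (invariant_layerGE _) ?_ hY).congr
    (finSumFinEquiv.trans (finCongr (by ring)))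
  rw [h1]
  exact subset_univ _

end PartialMaps

/-! ### From towers of functions to the Rokhlin dimension of `C₀(X)`, and back to freeness -/

open ZeroAtInftyContinuousMap

namespace ZeroAtInftyContinuousMap

variable {X : Type*} [TopologicalSpace X]

theorem norm_apply_le (f : C₀(X, ℂ)) (x : X) : ‖f x‖ ≤ ‖f‖ := f.toBCF.norm_coe_le_norm x

theorem norm_le_of_forall {f : C₀(X, ℂ)} {c : ℝ} (hc : 0 ≤ c) (h : ∀ x, ‖f x‖ ≤ c) : ‖f‖ ≤ c :=
  (BoundedContinuousFunction.norm_le (f := f.toBCF) hc).2 h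

theorem finsetSum_apply {ι : Type*} (s : Finset ι) (f : ι → C₀(X, ℂ)) (x : X) :
    (∑ i ∈ s, f i) x = ∑ i ∈ s, f i x := by
  classical
  induction s using Finset.induction_on with
  | empty => simp
  | insert i s hi ih => rw [Finset.sum_insert hi, Finset.sum_insert hi, add_apply, ih]

theorem isCompact_setOf_le_norm (f : C₀(X, ℂ)) {δ : ℝ} (hδ : 0 < δ) :
    IsCompact {x | δ ≤ ‖f x‖} := by
  have h : ∀ᶠ x in cocompact X, ‖f x‖ < δ := by
    have := (zero_at_infty f).norm
    rw [norm_zero] at this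
    exact this.eventually_lt_const hδ
  obtain ⟨C, hC, hCs⟩ := mem_cocompact.1 h
  refine hC.of_isClosed_subset (isClosed_le continuous_const (map_continuous f).norm) fun x hx => ?_
  by_contra hxC
  have h1 : ‖f x‖ < δ := hCs hxC
  exact absurd h1 (not_lt.2 hx)

end ZeroAtInftyContinuousMap

section Cutoff

variable {X : Type*} [TopologicalSpace X] {f : X → ℝ} {U : Set X}

/-- A cut-off function as an element of `C₀(X)`. -/
noncomputable def IsCutoff.toC₀ (hf : IsCutoff f U) : C₀(X, ℂ) where
  toFun x := (f x : ℂ)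
  continuous_toFun := Complex.continuous_ofReal.comp hf.continuous
  zero_at_infty' := (hf.compact.comp_left (g := ((↑) : ℝ → ℂ)) Complex.ofReal_zero).is_zero_at_infty

@[simp] theorem IsCutoff.toC₀_apply (hf : IsCutoff f U) (x : X) : hf.toC₀ x = (f x : ℂ) := rfl

theorem IsCutoff.sqrt (hf : IsCutoff f U) : IsCutoff (fun x => √(f x)) U where
  continuous := hf.continuous.sqrt
  compact := hf.compact.comp_left Real.sqrt_zero
  tsupport_subset := (closure_mono fun x (hx : √(f x) ≠ 0) (h : f x = 0) =>
    hx (by rw [h, Real.sqrt_zero])).trans hf.tsupport_subset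
  nonneg x := Real.sqrt_nonneg _
  le_one x := Real.sqrt_le_one.2 (hf.le_one x)

theorem IsCutoff.toC₀_eq_star_mul (hf : IsCutoff f U) :
    hf.toC₀ = star hf.sqrt.toC₀ * hf.sqrt.toC₀ := by
  ext x
  simp only [mul_apply, star_apply, toC₀_apply, Complex.star_def, Complex.conj_ofReal]
  rw [← Complex.ofReal_mul, Real.mul_self_sqrt (hf.nonneg x)]

theorem IsCutoff.norm_toC₀_le (hf : IsCutoff f U) : ‖hf.toC₀‖ ≤ 1 :=
  norm_le_of_forall zero_le_one fun x => by
    rw [toC₀_apply, Complex.norm_real, Real.norm_of_nonneg (hf.nonneg x)]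
    exact hf.le_one x

end Cutoff

namespace TopPartialAction

variable {G X : Type*} [Group G] [TopologicalSpace X] (θ : TopPartialAction G X)

open Classical in
/-- The total maps that extend the homeomorphisms of a topological partial action by the
identity. -/
noncomputable def toPartialMaps : PartialMaps G X where
  src g := θ.dom g⁻¹
  map g x := if h : x ∈ θ.dom g⁻¹ then θ.act g ⟨x, h⟩ else x
  src_one := by rw [inv_one, θ.dom_one]; rfl
  map_one x := by
    split_ifs with h
    · exact θ.act_one ⟨x, h⟩
    · rfl
  map_mem g x hx := by
    have hx' : x ∈ θ.dom g⁻¹ := hx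
    rw [dif_pos hx', inv_inv]
    exact (θ.act g ⟨x, hx'⟩).2
  mul_mem g h x hx hgx := by
    have hx' : x ∈ θ.dom h⁻¹ := hx
    rw [dif_pos hx'] at hgx
    exact (θ.act_mul g h ⟨x, hx'⟩ hgx).choose
  map_mul g h x hx hgx := by
    have hx' : x ∈ θ.dom h⁻¹ := hx
    rw [dif_pos hx'] at hgx
    obtain ⟨h1, h2⟩ := θ.act_mul g h ⟨x, hx'⟩ hgx
    have hgx' : (θ.act h ⟨x, hx'⟩ : X) ∈ θ.dom g⁻¹ := hgx
    rw [dif_pos h1, dif_pos hx', dif_pos hgx', h2]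

theorem toPartialMaps_map {g : G} (x : θ.dom g⁻¹) : θ.toPartialMaps.map g x = θ.act g x :=
  dif_pos x.2

theorem isOpen_toPartialMaps_src (g : G) : IsOpen (θ.toPartialMaps.src g) := (θ.dom g⁻¹).isOpen

theorem continuousOn_toPartialMaps_map (g : G) :
    ContinuousOn (θ.toPartialMaps.map g) (θ.toPartialMaps.src g) := by
  rw [continuousOn_iff_continuous_domRestrict]
  have : (θ.toPartialMaps.src g).domRestrict (θ.toPartialMaps.map g) =
      fun x : θ.dom g⁻¹ => (θ.act g x : X) := funext fun x => θ.toPartialMaps_map x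
  rw [this]
  exact continuous_subtype_val.comp (θ.act g).continuous

theorem IsFree.toPartialMaps {θ : TopPartialAction G X} (h : θ.IsFree) :
    θ.toPartialMaps.IsFree := fun g x hx hgx => by
  by_contra hg
  exact h g hg ⟨x, hx⟩ ((θ.toPartialMaps_map ⟨x, hx⟩).symm.trans hgx)

variable [T2Space X]

theorem toCStar_act_apply {g : G} (f : θ.toCStar.dom g⁻¹) (x : θ.dom g⁻¹) :
    (θ.toCStar.act g f : C₀(X, ℂ)) (θ.act g x) = (f : C₀(X, ℂ)) x :=
  push_apply (θ.act g) f x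

theorem toCStar_act_apply_of_notMem {g : G} (f : θ.toCStar.dom g⁻¹) {y : X} (hy : y ∉ θ.dom g) :
    (θ.toCStar.act g f : C₀(X, ℂ)) y = 0 :=
  push_of_notMem (θ.act g) f hy

variable [Fintype G]

/-- Tower estimates are needed only on the compact sets where the elements of `F` are not small;
elsewhere the small factor `a` or `x` wins against bounded tower terms. Centrality is automatic by
commutativity. -/
theorem rokhlinDimLE_of_hasTowers {d : ℕ} (h : θ.toPartialMaps.HasTowers univ (Fin (d + 1))) :
    θ.toCStar.RokhlinDimLE d := by
  classical
  intro ε hε F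
  obtain ⟨R, hR1, hR⟩ : ∃ R : ℝ, 1 ≤ R ∧ ∀ a ∈ F, ‖a‖ ≤ R := by
    refine ⟨1 + ∑ a ∈ F, ‖a‖, le_add_of_nonneg_right (Finset.sum_nonneg fun _ _ => norm_nonneg _),
      fun a ha => ?_⟩
    have := Finset.single_le_sum (f := fun a : C₀(X, ℂ) => ‖a‖) (fun _ _ => norm_nonneg _) ha
    linarith
  set m : ℝ := (((d + 1) * Fintype.card G : ℕ) : ℝ) with hm
  have hm0 : 0 ≤ m := Nat.cast_nonneg _
  -- `R` bounds the norms in `F`, and `m + 1` bounds the defect of the sum off `K`. Aiming at `ε /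
  -- 2` yields strict inequalities for suprema.
  set δ : ℝ := ε / (2 * (R ^ 2 * (m + 1))) with hδdef
  have hR0 : 0 < R := by linarith
  have hδ : 0 < δ := by positivity
  have hδε : δ * (R ^ 2 * (m + 1)) = ε / 2 := by
    rw [hδdef]
    field_simp
  have hb1 : δ * R ≤ ε / 2 := by
    rw [← hδε]
    refine mul_le_mul_of_nonneg_left ?_ hδ.le
    nlinarith [mul_nonneg hm0 (sq_nonneg R)]
  have hb2 : δ * R * R ≤ ε / 2 := by
    rw [← hδε, mul_assoc]
    refine mul_le_mul_of_nonneg_left ?_ hδ.le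
    nlinarith [mul_nonneg hm0 (sq_nonneg R)]
  have hb3 : (m + 1) * δ ≤ ε / 2 := by
    rw [← hδε, mul_comm]
    refine mul_le_mul_of_nonneg_left ?_ hδ.le
    exact le_mul_of_one_le_left (by positivity) (by nlinarith)
  set K : Set X := ⋃ a ∈ F, {x | δ ≤ ‖a x‖} with hK
  have hKc : IsCompact K := F.isCompact_biUnion fun a _ => isCompact_setOf_le_norm a hδ
  have hKs : ∀ a ∈ F, ∀ x ∉ K, ‖a x‖ ≤ δ := fun a ha x hx => by
    by_contra hlt
    exact hx (mem_iUnion₂.2 ⟨a, ha, (not_le.1 hlt).le⟩)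
  set C : G → Set X := fun g => ⋃ a ∈ F.filter (· ∈ θ.toCStar.dom g⁻¹), {x | δ ≤ ‖a x‖} with hC
  have hCc : ∀ g, IsCompact (C g) := fun g =>
    Finset.isCompact_biUnion _ fun a _ => isCompact_setOf_le_norm a hδ
  have hCs : ∀ g, C g ⊆ θ.toPartialMaps.src g := fun g x hx => by
    obtain ⟨a, ha, hax⟩ := mem_iUnion₂.1 hx
    by_contra hxs
    have h0 : a x = 0 := (Finset.mem_filter.1 ha).2 x hxs
    rw [mem_ofPred_eq, h0, norm_zero] at hax
    exact absurd hδ (not_lt.2 hax)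
  have hCa : ∀ g, ∀ a ∈ F, a ∈ θ.toCStar.dom g⁻¹ → ∀ x ∉ C g, ‖a x‖ ≤ δ :=
    fun g a ha hag x hx => by
      by_contra hlt
      exact hx (mem_iUnion₂.2 ⟨a, Finset.mem_filter.2 ⟨ha, hag⟩, (not_le.1 hlt).le⟩)
  obtain ⟨f, hf⟩ := h K (subset_univ K) hKc C hCc hCs δ hδ
  have hlt : ∀ {a : C₀(X, ℂ)}, (∀ x, ‖a x‖ ≤ ε / 2) → ‖a‖ < ε := fun {a} ha =>
    (norm_le_of_forall (by linarith) ha).trans_lt (by linarith)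
  have hval : ∀ a ∈ F, ∀ x, ‖a x‖ ≤ R := fun a ha x => (norm_apply_le a x).trans (hR a ha)
  have hf0 : ∀ j g x, 0 ≤ f j g x := fun j g => (hf.isCutoff j g).nonneg
  have hf1 : ∀ j g x, f j g x ≤ 1 := fun j g => (hf.isCutoff j g).le_one
  refine ⟨fun j g => (hf.isCutoff j g).toC₀, fun j g x hx => ?_,
    fun j g => ⟨_, (hf.isCutoff j g).toC₀_eq_star_mul⟩, fun j g => (hf.isCutoff j g).norm_toC₀_le,
    fun j g k a ha x hx => hlt fun y => ?_, fun j g k hgk a ha => hlt fun x => ?_,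
    fun a ha => hlt fun x => ?_, fun j g a ha b hb => hlt fun x => ?_⟩
  · rw [IsCutoff.toC₀_apply, (hf.isCutoff j g).eq_zero (fun h => hx ?_), Complex.ofReal_zero]
    have h2 : x ∈ θ.dom g⁻¹⁻¹ := h.2
    rwa [inv_inv] at h2
  · by_cases hy : y ∈ θ.dom g
    · obtain ⟨z, hz⟩ := (θ.act g).surjective ⟨y, hy⟩
      have hzy : (θ.act g z : X) = y := congrArg Subtype.val hz
      rw [mul_apply, ZeroAtInftyContinuousMap.sub_apply, mul_apply, ← hzy, toCStar_act_apply, toCStar_act_apply]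
      simp only [mul_apply, IsCutoff.toC₀_apply]
      rw [← sub_mul, ← Complex.ofReal_sub, norm_mul, norm_mul, Complex.norm_real, Real.norm_eq_abs]
      have h1 : |f j k z - f j (g * k) (θ.act g z)| ≤ 1 := abs_sub_le_iff.2
        ⟨by linarith [hf0 j (g * k) (θ.act g z), hf1 j k z],
          by linarith [hf0 j k z, hf1 j (g * k) (θ.act g z)]⟩
      have h2 := hval _ hx z
      have h3 := hval _ ha (θ.act g z)
      by_cases hyK : (θ.act g z : X) ∈ K
      · by_cases hzC : (z : X) ∈ C g ∧ (z : X) ∈ K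
        · have h4 := hf.equivariant j g k z hzC.1 hzC.2 (by rwa [toPartialMaps_map])
          rw [toPartialMaps_map] at h4
          refine le_trans ?_ hb2
          gcongr
        · have h4 : ‖(x : C₀(X, ℂ)) z‖ ≤ δ := by
            by_cases hzC' : (z : X) ∈ C g
            · exact hKs _ hx _ fun h => hzC ⟨hzC', h⟩
            · exact hCa g _ hx x.2 _ hzC'
          refine le_trans ?_ hb1
          calc _ ≤ 1 * δ * R := by gcongr
            _ = δ * R := by ring
      · have h4 := hKs a ha _ hyK
        refine le_trans ?_ hb1
        calc _ ≤ 1 * R * δ := by gcongr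
          _ = δ * R := by ring
    · rw [mul_apply, ZeroAtInftyContinuousMap.sub_apply, mul_apply, toCStar_act_apply_of_notMem _ _ hy,
        toCStar_act_apply_of_notMem _ _ hy]
      simp only [mul_zero, sub_zero, zero_mul, norm_zero]
      linarith
  · simp only [mul_apply, IsCutoff.toC₀_apply]
    rw [← Complex.ofReal_mul, norm_mul, Complex.norm_real,
      Real.norm_of_nonneg (mul_nonneg (hf0 _ _ _) (hf0 _ _ _))]
    refine le_trans ?_ hb1
    by_cases hxK : x ∈ K
    · exact mul_le_mul (hf.orthogonal j g k hgk x hxK) (hval a ha x) (norm_nonneg _) hδ.le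
    · have h1 := mul_le_one₀ (hf1 j g x) (hf0 j k x) (hf1 j k x)
      calc _ ≤ 1 * δ := mul_le_mul h1 (hKs a ha x hxK) (norm_nonneg _) zero_le_one
        _ ≤ δ * R := by rw [one_mul]; exact le_mul_of_one_le_right hδ.le hR1
  · have hsum : ((∑ j, ∑ g, (hf.isCutoff j g).toC₀) * a - a) x =
        ((∑ j, ∑ g, f j g x - 1 : ℝ) : ℂ) * a x := by
      simp only [ZeroAtInftyContinuousMap.sub_apply, mul_apply, finsetSum_apply, IsCutoff.toC₀_apply]
      push_cast
      ring
    rw [hsum, norm_mul, Complex.norm_real, Real.norm_eq_abs]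
    by_cases hxK : x ∈ K
    · exact (mul_le_mul (hf.sum_one x hxK) (hval a ha x) (norm_nonneg _) hδ.le).trans hb1
    · have h0 : 0 ≤ ∑ j, ∑ g, f j g x :=
        Finset.sum_nonneg fun j _ => Finset.sum_nonneg fun g _ => hf0 j g x
      have h1 : ∑ j, ∑ g, f j g x ≤ m := by
        calc _ ≤ ∑ _j : Fin (d + 1), ∑ _g : G, (1 : ℝ) :=
              Finset.sum_le_sum fun j _ => Finset.sum_le_sum fun g _ => hf1 j g x
          _ = m := by simp [hm]
      have h2 : |∑ j, ∑ g, f j g x - 1| ≤ m + 1 := abs_le.2 ⟨by linarith, by linarith⟩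
      exact (mul_le_mul h2 (hKs a ha x hxK) (norm_nonneg _) (by positivity)).trans hb3
  · have : ((hf.isCutoff j g).toC₀ * b - b * (hf.isCutoff j g).toC₀) = 0 := by
      rw [mul_comm, sub_self]
    rw [this, zero_mul, ZeroAtInftyContinuousMap.zero_apply, norm_zero]
    linarith

theorem isFree_of_rokhlinDimLE [LocallyCompactSpace X] {d : ℕ} (h : θ.toCStar.RokhlinDimLE d) : θ.IsFree := by
  intro g hg x hx
  obtain ⟨b, hb, hb1⟩ := exists_isCutoff (isCompact_singleton (x := (x : X)))
    (θ.dom g⁻¹).isOpen (singleton_subset_iff.2 x.2)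
  set a : C₀(X, ℂ) := hb.toC₀ with ha
  have hax : a x = 1 := by simp [ha, hb1]
  have hadom : a ∈ θ.toCStar.dom g⁻¹ := fun y hy => by simp [ha, hb.eq_zero hy]
  set m : ℝ := (((d + 1) * Fintype.card G : ℕ) : ℝ) with hm
  have hm0 : 0 ≤ m := Nat.cast_nonneg _
  -- There are `m` tower values at `x`, each shown to be at most `η`, so `1 ≤ m η + η ^ 2 / 2`,
  -- contradicting `(m + 2) η = 1`.
  set η : ℝ := 1 / (m + 2) with hη
  have hη0 : 0 < η := by positivity
  have hη1 : (m + 2) * η = 1 := by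
    rw [hη]
    field_simp
  obtain ⟨f, hf⟩ := h (η ^ 2 / 2) (by positivity) {a}
  have hav : ∀ {u : C₀(X, ℂ)}, ‖u‖ < η ^ 2 / 2 → ‖u x‖ < η ^ 2 / 2 := fun hu =>
    (norm_apply_le _ _).trans_lt hu
  have haF : a ∈ ({a} : Finset C₀(X, ℂ)) := Finset.mem_singleton_self a
  have hsmall : ∀ j k, ‖f j k x‖ ≤ η := fun j k => by
    have h1 := hav (hf.equivariant j g k a haF ⟨a, hadom⟩ haF)
    have h2 := hav (hf.orthogonal j k (g * k) (fun h => hg (by simpa using h.symm)) a haF)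
    -- Since `θ_g` fixes `x`, evaluation at `x` does not see `α_g`, so equivariance compares `f j k`
    -- with `f j (g * k)` at the same point.
    have h3 : ∀ u : θ.toCStar.dom g⁻¹, (θ.toCStar.act g u : C₀(X, ℂ)) x = (u : C₀(X, ℂ)) x :=
      fun u => by rw [← θ.toCStar_act_apply u x, hx]
    simp only [mul_apply, ZeroAtInftyContinuousMap.sub_apply, h3, hax, mul_one] at h1 h2
    have h4 : ‖f j k x‖ ≤ 1 := (norm_apply_le _ _).trans (hf.norm_le_one j k)
    have h5 : f j k x * f j k x =
        f j k x * (f j k x - f j (g * k) x) + f j k x * f j (g * k) x := by ring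
    have h6 : ‖f j k x‖ * ‖f j k x‖ ≤ η ^ 2 := by
      rw [← norm_mul, h5]
      refine (norm_add_le _ _).trans ?_
      rw [norm_mul]
      have := mul_le_of_le_one_left (norm_nonneg (f j k x - f j (g * k) x)) h4
      linarith
    exact abs_le_of_sq_le_sq' (by linarith [sq ‖f j k x‖]) hη0.le |>.2
  have h1 := hav (hf.sum_one a haF)
  simp only [mul_apply, ZeroAtInftyContinuousMap.sub_apply, finsetSum_apply, hax, mul_one] at h1
  have h2 : ‖∑ j, ∑ k, f j k x‖ ≤ m * η := by
    calc _ ≤ ∑ _j : Fin (d + 1), ∑ _k : G, η :=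
          norm_sum_le_of_le _ fun j _ => norm_sum_le_of_le _ fun k _ => hsmall j k
      _ = m * η := by simp [hm]; ring
  have h3 : (1 : ℝ) ≤ ‖∑ j, ∑ k, f j k x‖ + ‖∑ j, ∑ k, f j k x - 1‖ := by
    have := norm_sub_le (∑ j, ∑ k, f j k x) (∑ j, ∑ k, f j k x - 1)
    rwa [sub_sub_cancel, norm_one] at this
  nlinarith [mul_pos hη0 hη0]

end TopPartialAction

theorem CStarPartialAction.exists_rokhlinDimLE_of_rokhlinDim_lt_top {G A : Type*} [Group G]
    [Fintype G] [NonUnitalCStarAlgebra A] {α : CStarPartialAction G A} (h : α.rokhlinDim < ⊤) :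
    ∃ d, α.RokhlinDimLE d := by
  by_contra! hne
  simp [rokhlinDim, hne] at h

theorem theorem5p8 {G : Type*} [Group G] [Fintype G] {X : Type*} [TopologicalSpace X]
    [LocallyCompactSpace X] [T2Space X] (θ : TopPartialAction G X) :
    (θ.toCStar.rokhlinDim < ⊤ → θ.IsFree) ∧
    (coveringDim X < ⊤ →
      (θ.toCStar.rokhlinDim < ⊤ ↔ θ.IsFree) ∧
      (θ.IsFree → θ.toCStar.rokhlinDim ≤
        ((Fintype.card G - 1 : ℕ) : ℕ∞) * (coveringDim X + 1))) := by
  have ha : θ.toCStar.rokhlinDim < ⊤ → θ.IsFree := fun h =>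
    θ.isFree_of_rokhlinDimLE
      (CStarPartialAction.exists_rokhlinDimLE_of_rokhlinDim_lt_top h).choose_spec
  refine ⟨ha, fun hX => ?_⟩
  obtain ⟨n, hn, hXn⟩ := exists_coveringDimLE_of_coveringDim_lt_top hX
  have hb : θ.IsFree → θ.toCStar.rokhlinDim ≤
      (((Fintype.card G - 1) * (n + 1) : ℕ) : ℕ∞) := fun hfree =>
    iInf₂_le _ (θ.rokhlinDimLE_of_hasTowers (PartialMaps.hasTowers_univ hfree.toPartialMaps
      θ.isOpen_toPartialMaps_src θ.continuousOn_toPartialMaps_map hn))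
  refine ⟨⟨ha, fun hfree => (hb hfree).trans_lt (ENat.natCast_lt_top _)⟩, fun hfree => ?_⟩
  rw [hXn]
  exact_mod_cast hb hfree
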